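/- Let $k\ge 1$ and let $\alpha_1,\dots,\alpha_k>0$ be constants with $\alpha_1+\cdots+\alpha_k=1$. Put $\beta=(\min_{1\le i\le k}\alpha_i)^{-1}$. Let $p=p(n)=(\log n+\log\log n+\omega)/n$, where $\omega=\omega(n)\to\infty$ as $n\to\infty$ and $\beta p\le 1$ for all sufficiently large $n$. Let $G_{n,\beta p;\boldsymbol\alpha}$ be the binomial random graph on $n$ vertices with edge probability $\beta p$ in which each edge independently receives a random colour, colour $i$ with probability $\alpha_i$. For each $n$ let $\mathbf c=(c_1,\dots,c_n)\in\{1,\dots,k\}^n$ be an arbitrary fixed sequence of colours (it may depend on $n$). Then, with probability tending to $1$ as $n\to\infty$, $G_{n,\beta p;\boldsymbol\alpha}$ contains a Hamilton cycle $(x_1,x_2,\dots,x_n,x_1)$ such that the edge $\{x_i,x_{i+1}\}$ has colour $c_i$ for $i=1,\dots,n$, where $x_{n+1}=x_1$. -/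

import Mathlib

open MeasureTheory SimpleGraph Filter Topology
open scoped unitInterval

noncomputable section

/-- The law of one random colour: colour `i` has probability `α i`. -/
def colourLaw {k : ℕ} (α : Fin k → ℝ) : Measure (Fin k) :=
  ∑ i, ENNReal.ofReal (α i) • Measure.dirac i

/-- The random edge-coloured graph `G_{n,q;α}` on the vertex set `Fin n`: the law of a pair
`(G, χ)` in which `G` is the binomial random graph with edge probability `q` and, independently
of `G`, the pairs of vertices receive independent colours `χ e` with law `α`. Only the colours of
the edges of `G` are meaningful. -/
def randomColouredGraph (n : ℕ) (q : I) {k : ℕ} (α : Fin k → ℝ) :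
    Measure (SimpleGraph (Fin n) × (Sym2 (Fin n) → Fin k)) :=
  (binomialRandom (Fin n) q).prod (Measure.pi fun _ => colourLaw α)

/-- `G`, with its edges coloured by `χ`, contains a Hamilton cycle `(x₁, x₂, …, xₙ, x₁)` whose
consecutive edges `{x₁, x₂}, {x₂, x₃}, …, {xₙ, x₁}` have colours `c₁, c₂, …, cₙ`. -/
def HasColouredHamiltonCycle {n k : ℕ} (c : Fin n → Fin k) (G : SimpleGraph (Fin n))
    (χ : Sym2 (Fin n) → Fin k) : Prop :=
  ∃ (v : Fin n) (w : G.Walk v v), w.IsHamiltonianCycle ∧ w.edges.map χ = List.ofFn c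

end

/-! Put p = q · min α, so that any prescribed colour occurs on an edge at a given pair with
probability at least p. McDiarmid's comparison (`bexp_pattern_le_pexp`) then removes the colours.
Let every pair carry its set of available colours: its own colour if it is an edge, none otherwise.
Replace these random sets, one pair at a time, by all colours with probability p and none otherwise.
For n ≥ 3 a Hamilton cycle uses a pair at most once, so with the other sets fixed it asks for one
colour at that pair, and the exchange cannot make a correctly coloured cycle more likely. At the end
the event is that the binomial random graph of density p is Hamiltonian.

It remains to prove that this graph is Hamiltonian with probability tending to 1
(`tendsto_bexp_nonHamiltonian`). Its edges are exposed in two stages.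

Most of the density already yields an expander. A smallest set S with fewer than 2|S| outer
neighbours spans, together with them, a connected set U with |U| < 3|S|, and no edge leaves S
outside U. Summing over S, U and the edges of a tree on U bounds the failure probability by a
constant times n · np · exp(-np), plus an exponentially small term. The leading term comes from |S|
= 1, |U| ≤ 2, that is, vertices of degree at most 1; it tends to 0 exactly because of the summand
log log n.

The rest of the density is sprinkled in 2n rounds. By Pósa's lemma an expander without Hamilton
cycle has at least n²/32 boosters, pairs which close a longest path to a Hamilton cycle or lead to a
longer path (`IsExpander.exists_boosters`). Each round hits a booster with probability at least
15/16, and n advances suffice (`sprinkle_nonHamiltonian_le`). -/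

noncomputable section

/-! ### Finite product expectations -/

/-- The expectation of `f` under the product over `E` of the weights `μ e` on a finite type. -/
def pexp {E Ω : Type*} [Fintype E] [DecidableEq E] [Fintype Ω] (μ : E → Ω → ℝ)
    (f : (E → Ω) → ℝ) : ℝ :=
  ∑ x, (∏ e, μ e (x e)) * f x

section pexp

variable {E Ω Ω' : Type*} [Fintype E] [DecidableEq E] [Fintype Ω] [Fintype Ω']
  {μ : E → Ω → ℝ} {f g : (E → Ω) → ℝ}

theorem pexp_prod (μ : E → Ω → ℝ) (g : E → Ω → ℝ) :
    pexp μ (fun x => ∏ e, g e (x e)) = ∏ e, ∑ a, μ e a * g e a := by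
  simp [pexp, Finset.prod_univ_sum, Finset.prod_mul_distrib]

theorem pexp_const (hμ : ∀ e, ∑ a, μ e a = 1) (c : ℝ) : pexp μ (fun _ => c) = c := by
  have := pexp_prod μ (fun _ _ => (1 : ℝ))
  simp only [pexp, Finset.prod_const_one, mul_one, hμ] at this
  rw [pexp, ← Finset.sum_mul, this, one_mul]

theorem pexp_mono (hμ : ∀ e a, 0 ≤ μ e a) (h : ∀ x, f x ≤ g x) : pexp μ f ≤ pexp μ g :=
  Finset.sum_le_sum fun x _ =>
    mul_le_mul_of_nonneg_left (h x) (Finset.prod_nonneg fun e _ => hμ e _)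

theorem pexp_add (μ : E → Ω → ℝ) (f g : (E → Ω) → ℝ) :
    pexp μ (fun x => f x + g x) = pexp μ f + pexp μ g := by
  simp [pexp, mul_add, Finset.sum_add_distrib]

theorem pexp_sum {ι : Type*} (s : Finset ι) (μ : E → Ω → ℝ) (f : ι → (E → Ω) → ℝ) :
    pexp μ (fun x => ∑ i ∈ s, f i x) = ∑ i ∈ s, pexp μ (f i) := by
  simp only [pexp, Finset.mul_sum]
  exact Finset.sum_comm

theorem pexp_const_mul (c : ℝ) (μ : E → Ω → ℝ) (f : (E → Ω) → ℝ) :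
    pexp μ (fun x => c * f x) = c * pexp μ f := by
  simp only [pexp, Finset.mul_sum]
  exact Finset.sum_congr rfl fun _ _ => by ring

theorem pexp_map [DecidableEq Ω'] (μ : E → Ω → ℝ) (h : E → Ω → Ω') (f : (E → Ω') → ℝ) :
    pexp μ (fun x => f (fun e => h e (x e))) =
      pexp (fun e b => ∑ a, if h e a = b then μ e a else 0) f := by
  classical
  simp only [pexp, Finset.prod_univ_sum, Fintype.piFinset_univ, Finset.sum_mul]
  rw [Finset.sum_comm]
  refine Finset.sum_congr rfl fun x _ => ?_
  rw [Finset.sum_eq_single (fun e => h e (x e))]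
  · simp
  · intro y _ hy
    obtain ⟨e, he⟩ : ∃ e, h e (x e) ≠ y e := by
      by_contra! hc
      exact hy (funext fun e => (hc e).symm)
    rw [Finset.prod_eq_zero (Finset.mem_univ e) (by simp [he]), zero_mul]
  · simp

theorem pexp_pair (μ : E → Ω → ℝ) (ν : E → Ω' → ℝ) (f : (E → Ω) → (E → Ω') → ℝ) :
    pexp μ (fun x => pexp ν (f x)) =
      pexp (fun e (a : Ω × Ω') => μ e a.1 * ν e a.2)
        (fun z => f (fun e => (z e).1) (fun e => (z e).2)) := by
  simp only [pexp, Finset.prod_mul_distrib, Finset.mul_sum]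
  rw [← Fintype.sum_prod_type', ← (Equiv.arrowProdEquivProdArrow E (fun _ => Ω) (fun _ => Ω')).sum_comp]
  exact Finset.sum_congr rfl fun z _ => by
    simp [Equiv.arrowProdEquivProdArrow, mul_assoc]

theorem pexp_update (lam : E → Ω → ℝ) (e : E) (m : Ω → ℝ) (f : (E → Ω) → ℝ) :
    pexp (Function.update lam e m) f =
      ∑ y : {j // j ≠ e} → Ω, (∏ j : {j // j ≠ e}, lam j (y j)) *
        ∑ a, m a * f ((Equiv.funSplitAt e Ω).symm (a, y)) := by
  rw [pexp, ← (Equiv.funSplitAt e Ω).symm.sum_comp, Fintype.sum_prod_type, Finset.sum_comm]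
  refine Finset.sum_congr rfl fun y _ => ?_
  rw [Finset.mul_sum]
  refine Finset.sum_congr rfl fun a _ => ?_
  rw [Fintype.prod_eq_mul_prod_subtype_ne _ e]
  have h1 : (Equiv.funSplitAt e Ω).symm (a, y) e = a := by simp [Equiv.funSplitAt, Equiv.piSplitAt]
  have h2 : ∀ j : {j // j ≠ e}, (Equiv.funSplitAt e Ω).symm (a, y) j = y j := fun j => by
    simp [Equiv.funSplitAt, Equiv.piSplitAt, j.2]
  have h3 : ∀ j : {j // j ≠ e}, Function.update lam e m j = lam j := fun j =>
    Function.update_of_ne j.2 _ _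
  simp only [h1, h2, h3, Function.update_self]
  ring

/-- Fubini: the law at `e` enters only through the inner sum over that coordinate, so it is enough
to compare with all other coordinates fixed. -/
theorem pexp_update_le {lam : E → Ω → ℝ} (hlam : ∀ e a, 0 ≤ lam e a) (e : E) (m m' : Ω → ℝ)
    (f : (E → Ω) → ℝ)
    (h : ∀ x : E → Ω, ∑ a, m a * f (Function.update x e a) ≤
      ∑ a, m' a * f (Function.update x e a)) :
    pexp (Function.update lam e m) f ≤ pexp (Function.update lam e m') f := by
  rw [pexp_update, pexp_update]
  refine Finset.sum_le_sum fun y _ =>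
    mul_le_mul_of_nonneg_left ?_ (Finset.prod_nonneg fun j _ => hlam _ _)
  by_cases hΩ : Nonempty Ω
  · obtain ⟨a₀⟩ := hΩ
    have key : ∀ a, Function.update ((Equiv.funSplitAt e Ω).symm (a₀, y)) e a =
        (Equiv.funSplitAt e Ω).symm (a, y) := fun a => by
      funext j
      by_cases hj : j = e
      · subst hj; simp [Equiv.funSplitAt, Equiv.piSplitAt]
      · simp [Equiv.funSplitAt, Equiv.piSplitAt, hj]
    simpa only [key] using h ((Equiv.funSplitAt e Ω).symm (a₀, y))
  · rw [not_nonempty_iff] at hΩ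
    simp

end pexp

/-! ### Random subsets of a finite set -/

/-- The Bernoulli weights with success probability `p`. -/
def bern (p : ℝ) (b : Bool) : ℝ := if b then p else 1 - p

/-- The expectation of `f` over a random subset of `E` to which every `e` belongs independently with
probability `p e`. -/
def bexp {E : Type*} [Fintype E] [DecidableEq E] (p : E → ℝ) (f : (E → Bool) → ℝ) : ℝ :=
  pexp (fun e => bern (p e)) f

section bexp

variable {E : Type*} [Fintype E] [DecidableEq E] {p q : E → ℝ} {f g : (E → Bool) → ℝ}

theorem bern_nonneg {p : ℝ} (h0 : 0 ≤ p) (h1 : p ≤ 1) (b : Bool) : 0 ≤ bern p b := by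
  cases b <;> simp [bern, h0, h1]

theorem bexp_mono (h0 : ∀ e, 0 ≤ p e) (h1 : ∀ e, p e ≤ 1) (h : ∀ x, f x ≤ g x) :
    bexp p f ≤ bexp p g :=
  pexp_mono (fun e => bern_nonneg (h0 e) (h1 e)) h

theorem bexp_const (p : E → ℝ) (c : ℝ) : bexp p (fun _ => c) = c :=
  pexp_const (by simp [bern]) c

theorem bexp_or (p q : E → ℝ) (f : (E → Bool) → ℝ) :
    bexp p (fun x => bexp q (fun y => f (x ⊔ y))) =
      bexp (fun e => p e + q e - p e * q e) f := by
  rw [bexp, show (fun x => bexp q (fun y => f (x ⊔ y))) =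
    fun x => pexp (fun e => bern (q e)) ((fun x y => f (x ⊔ y)) x) from rfl, pexp_pair]
  have := pexp_map (fun e (a : Bool × Bool) => bern (p e) a.1 * bern (q e) a.2)
    (fun _ a => a.1 ⊔ a.2) f
  rw [bexp]
  refine Eq.trans this ?_
  congr 1
  funext e b
  cases b <;> simp [Fintype.sum_prod_type, bern] <;> ring

/-- Coupling: a random set of density q is the union of one of density p and an independent one of
density (q - p) / (1 - p). -/
theorem bexp_antitone (hf : Antitone f) (h0 : ∀ e, 0 ≤ p e) (h : ∀ e, p e ≤ q e)
    (h1 : ∀ e, q e ≤ 1) : bexp q f ≤ bexp p f := by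
  have hr : ∀ e, p e + (q e - p e) / (1 - p e) - p e * ((q e - p e) / (1 - p e)) = q e := by
    intro e
    rcases eq_or_ne (p e) 1 with h' | h'
    -- The quotient is 0 by the convention on division by zero, and `q e = 1` is forced.
    · have := h e; have := h1 e
      simp [h']; linarith
    · have : 1 - p e ≠ 0 := sub_ne_zero.2 h'.symm
      field_simp; ring
  have key := bexp_or p (fun e => (q e - p e) / (1 - p e)) f
  simp only [hr] at key
  change _ = bexp q f at key
  rw [← key]
  refine bexp_mono h0 (fun e => (h e).trans (h1 e)) fun x => ?_
  refine (bexp_mono (g := fun _ => f x) (fun e => ?_) (fun e => ?_) fun y => hf le_sup_left).trans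
    (bexp_const _ _).le
  · exact div_nonneg (sub_nonneg.2 (h e)) (sub_nonneg.2 ((h e).trans (h1 e)))
  · exact div_le_one_of_le₀ (by linarith [h1 e]) (sub_nonneg.2 ((h e).trans (h1 e)))

/-- The probability that a random subset contains `s` and is disjoint from `t`. -/
theorem bexp_subset_disjoint (p : E → ℝ) (s t : Finset E) (hst : Disjoint s t) :
    bexp p (Set.indicator {x | (∀ e ∈ s, x e = true) ∧ (∀ e ∈ t, x e = false)} 1) =
      (∏ e ∈ s, p e) * ∏ e ∈ t, (1 - p e) := by
  classical
  have := pexp_prod (fun e => bern (p e)) (fun e b => if (e ∈ s → b = true) ∧ (e ∈ t → b = false)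
    then (1 : ℝ) else 0)
  have h2 : (fun x : E → Bool => ∏ e, if (e ∈ s → x e = true) ∧ (e ∈ t → x e = false)
      then (1 : ℝ) else 0) =
      Set.indicator {x | (∀ e ∈ s, x e = true) ∧ (∀ e ∈ t, x e = false)} 1 := by
    funext x
    rw [Finset.prod_ite_zero]
    simp [forall_and, Set.indicator_apply]
  have h3 : ∀ e, (∑ b, bern (p e) b * if (e ∈ s → b = true) ∧ (e ∈ t → b = false)
      then (1 : ℝ) else 0) = (if e ∈ s then p e else 1) * (if e ∈ t then 1 - p e else 1) := by
    intro e
    by_cases h : e ∈ s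
    · simp [bern, h, Finset.disjoint_left.1 hst h]
    · by_cases h' : e ∈ t <;> simp [bern, h, h']
  rw [h2] at this
  simp only [h3, Finset.prod_mul_distrib, Finset.prod_ite_mem, Finset.univ_inter] at this
  exact this

end bexp

/-! ### Comparing coloured and uncoloured patterns -/

/-- McDiarmid's comparison. Every element of `E` receives an independent random set of colours which
contains any given colour with probability at least `p e`. The probability that some `τ ∈ T` has
`c i` among the colours of `τ i` for all `i` is at least the probability that some `τ ∈ T` lies in a
random subset of density `p`. -/
theorem bexp_pattern_le_pexp {E C ι : Type*} [Fintype E] [DecidableEq E] [Fintype C]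
    [DecidableEq C] {T : Set (ι → E)} (hT : ∀ τ ∈ T, Function.Injective τ) (c : ι → C)
    {p : E → ℝ} (h0 : ∀ e, 0 ≤ p e) (h1 : ∀ e, p e ≤ 1) {μ : E → Finset C → ℝ}
    (hμ : ∀ e a, 0 ≤ μ e a) (hsum : ∀ e, ∑ a, μ e a = 1)
    (hp : ∀ e i, p e ≤ ∑ a, if i ∈ a then μ e a else 0) :
    bexp p (Set.indicator {x | ∃ τ ∈ T, ∀ i, x (τ i) = true} 1) ≤
      pexp μ (Set.indicator {A | ∃ τ ∈ T, ∀ i, c i ∈ A (τ i)} 1) := by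
  classical
  set h : Bool → Finset C := fun b => if b then Finset.univ else ∅ with hh
  set ν : E → Finset C → ℝ := fun e a => ∑ b, if h b = a then bern (p e) b else 0 with hν
  set Q : Set (E → Finset C) := {A | ∃ τ ∈ T, ∀ i, c i ∈ A (τ i)} with hQ
  have hstart : bexp p (Set.indicator {x | ∃ τ ∈ T, ∀ i, x (τ i) = true} 1) =
      pexp ν (Q.indicator 1) := by
    rw [hν, ← pexp_map (fun e => bern (p e)) (fun _ => h) (Q.indicator 1), bexp]
    congr 1
    funext x
    have : ((fun e => h (x e)) ∈ Q) ↔ x ∈ {x | ∃ τ ∈ T, ∀ i, x (τ i) = true} := by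
      refine exists_congr fun τ => and_congr_right fun _ => forall_congr' fun i => ?_
      cases hx : x (τ i) <;> simp [hh, hx]
    simp only [Set.indicator_apply, this, Pi.one_apply]
  have hν0 : ∀ e a, 0 ≤ ν e a := fun e a => Finset.sum_nonneg fun b _ => by
    split_ifs
    · exact bern_nonneg (h0 e) (h1 e) b
    · exact le_rfl
  have hmono : ∀ A B : E → Finset C, (∀ e, A e ⊆ B e) → A ∈ Q → B ∈ Q := by
    rintro A B hAB ⟨τ, hτ, hA⟩
    exact ⟨τ, hτ, fun i => hAB _ (hA i)⟩
  have hupd : ∀ (x : E → Finset C) e a b, a ⊆ b → ∀ j,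
      Function.update x e a j ⊆ Function.update x e b j := by
    intro x e a b hab j
    by_cases hj : j = e
    · subst hj; simpa using hab
    · simp [hj]
  have hind0 : ∀ x : E → Finset C, 0 ≤ Q.indicator (1 : (E → Finset C) → ℝ) x :=
    fun x => Set.indicator_nonneg (fun _ _ => zero_le_one) x
  -- With the sets off `e` fixed, either the event holds even with no colour at `e`, or it fails
  -- even with all colours, or some τ needs `e`. In the last case injectivity of τ leaves a single
  -- index `i` at `e`, and `c i` in the set suffices.
  have hstep : ∀ e (x : E → Finset C),
      ∑ a, ν e a * Q.indicator 1 (Function.update x e a) ≤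
        ∑ a, μ e a * Q.indicator 1 (Function.update x e a) := by
    intro e x
    have hl : ∑ a, ν e a * Q.indicator 1 (Function.update x e a) =
        p e * Q.indicator 1 (Function.update x e Finset.univ) +
          (1 - p e) * Q.indicator 1 (Function.update x e ∅) := by
      simp only [hν, Finset.sum_mul]
      rw [Finset.sum_comm]
      simp [bern, hh]
    rw [hl]
    by_cases hQ0 : Function.update x e ∅ ∈ Q
    · have hall : ∀ a, Function.update x e a ∈ Q := fun a =>
        hmono _ _ (hupd x e ∅ a (Finset.empty_subset a)) hQ0
      simp [hall, hsum]
    · by_cases hQ1 : Function.update x e Finset.univ ∈ Q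
      · obtain ⟨τ, hτ, hτc⟩ := hQ1
        obtain ⟨i, hi⟩ : ∃ i, τ i = e := by
          by_contra! hne
          refine hQ0 ⟨τ, hτ, fun i => ?_⟩
          have := hτc i
          rwa [Function.update_of_ne (hne i)] at this ⊢
        have hin : ∀ a, c i ∈ a → Function.update x e a ∈ Q := by
          refine fun a ha => ⟨τ, hτ, fun j => ?_⟩
          by_cases hj : j = i
          · subst hj; simpa [hi] using ha
          · have hne : τ j ≠ e := fun h => hj (hT τ hτ (h.trans hi.symm))
            have := hτc j
            rwa [Function.update_of_ne hne] at this ⊢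
        rw [Set.indicator_of_notMem hQ0, Set.indicator_of_mem (show _ ∈ Q from ⟨τ, hτ, hτc⟩)]
        simp only [Pi.one_apply, mul_one, mul_zero, add_zero]
        refine (hp e (c i)).trans (Finset.sum_le_sum fun a _ => ?_)
        split_ifs with ha
        · simp [hin a ha]
        · exact mul_nonneg (hμ e a) (hind0 _)
      · rw [Set.indicator_of_notMem hQ0, Set.indicator_of_notMem hQ1]
        simpa using Finset.sum_nonneg fun a _ => mul_nonneg (hμ e a) (hind0 _)
  -- Hybrid argument: `D` consists of the elements whose law has already been exchanged.
  have hyb : ∀ D : Finset E,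
      pexp ν (Q.indicator 1) ≤ pexp (fun e => if e ∈ D then μ e else ν e) (Q.indicator 1) := by
    intro D
    induction D using Finset.induction_on with
    | empty => simp
    | insert e D he ih =>
      refine ih.trans ?_
      have e1 : (fun j => if j ∈ D then μ j else ν j) =
          Function.update (fun j => if j ∈ D then μ j else ν j) e (ν e) := by
        rw [eq_comm, Function.update_eq_self_iff]; simp [he]
      have e2 : (fun j => if j ∈ insert e D then μ j else ν j) =
          Function.update (fun j => if j ∈ D then μ j else ν j) e (μ e) := by
        funext j
        by_cases hj : j = e
        · subst hj; simp
        · simp [hj]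
      rw [e1, e2]
      refine pexp_update_le (fun j a => ?_) e _ _ _ (hstep e)
      by_cases hj : j ∈ D <;> simp only [hj, if_true, if_false]
      exacts [hμ j a, hν0 j a]
  rw [hstart]
  simpa using hyb Finset.univ

/-! ### Pósa rotations -/

namespace SimpleGraph

variable {V : Type*} {G H : SimpleGraph V}

/-- A list of distinct vertices, consecutive ones being adjacent. -/
def IsPathList (G : SimpleGraph V) (l : List V) : Prop :=
  l.Nodup ∧ l.IsChain G.Adj

theorem IsPathList.mono {l : List V} (h : G.IsPathList l) (hGH : G ≤ H) : H.IsPathList l :=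
  ⟨h.1, h.2.imp fun _ _ hab => hGH hab⟩

/-- The path `l` is obtained from `l₀` by Pósa rotations which move the first vertex. -/
inductive Rotation (G : SimpleGraph V) (l₀ : List V) : List V → Prop
  | refl : Rotation G l₀ l₀
  | step {w x : V} {P A : List V} : Rotation G l₀ (w :: P ++ x :: A) → G.Adj w x →
      Rotation G l₀ ((w :: P).reverse ++ x :: A)

theorem isChain_rotate {R : V → V → Prop} (hR : ∀ ⦃a b⦄, R a b → R b a) {w x : V} {P A : List V}
    (h : (w :: P ++ x :: A).IsChain R) (hwx : R w x) :
    ((w :: P).reverse ++ x :: A).IsChain R := by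
  rw [List.isChain_append] at h ⊢
  refine ⟨?_, h.2.1, ?_⟩
  · rw [List.isChain_reverse]
    exact h.1.imp fun _ _ hab => hR hab
  · simpa using hwx

variable {l l₀ : List V}

theorem Rotation.perm (h : Rotation G l₀ l) : l.Perm l₀ := by
  induction h with
  | refl => exact List.Perm.refl _
  | step _ _ ih => exact ((List.reverse_perm _).append_right _).trans ih

theorem Rotation.getLast? (h : Rotation G l₀ l) : l.getLast? = l₀.getLast? := by
  induction h with
  | refl => rfl
  | step _ _ ih => rw [← ih, List.getLast?_append_of_ne_nil _ (by simp),
      List.getLast?_append_of_ne_nil _ (by simp)]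

theorem Rotation.isPathList (h : Rotation G l₀ l) (h₀ : G.IsPathList l₀) : G.IsPathList l := by
  refine ⟨h.perm.nodup_iff.2 h₀.1, ?_⟩
  induction h with
  | refl => exact h₀.2
  | step _ hwx ih => exact isChain_rotate (fun _ _ hab => hab.symm) ih hwx

/-- A rotation makes the last vertex before the pivot the new first vertex. -/
theorem Rotation.step' {w x z : V} {P Q A : List V} (h : Rotation G l₀ (w :: P ++ x :: A))
    (hwx : G.Adj w x) (hQ : w :: P = Q ++ [z]) :
    Rotation G l₀ (z :: (Q.reverse ++ x :: A)) := by
  have := h.step hwx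
  rw [hQ] at this
  simpa using this

variable [Fintype V]

open Classical in
/-- The first vertices of the paths obtained from `l₀` by rotations. -/
def rotationEnds (G : SimpleGraph V) (l₀ : List V) : Finset V :=
  {u | ∃ l, Rotation G l₀ (u :: l)}

theorem mem_rotationEnds {u : V} : u ∈ G.rotationEnds l₀ ↔ ∃ l, Rotation G l₀ (u :: l) := by
  simp [rotationEnds]

open Classical in
/-- The vertices outside `S` with a neighbour in `S`. -/
def outerNeighbors (G : SimpleGraph V) (S : Finset V) : Finset V :=
  {y | y ∉ S ∧ ∃ u ∈ S, G.Adj u y}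

theorem mem_outerNeighbors {S : Finset V} {y : V} :
    y ∈ G.outerNeighbors S ↔ y ∉ S ∧ ∃ u ∈ S, G.Adj u y := by
  simp [outerNeighbors]

/-- Every set of at most a quarter of the vertices has at least twice as many outer neighbours. -/
def IsExpander (G : SimpleGraph V) : Prop :=
  ∀ S : Finset V, S.Nonempty → 4 * S.card ≤ Fintype.card V →
    2 * S.card ≤ (G.outerNeighbors S).card

/-- A list of all the vertices in the order of a Hamilton cycle. -/
def IsHamiltonList (G : SimpleGraph V) (l : List V) : Prop :=
  G.IsPathList l ∧ l.length = Fintype.card V ∧ ∃ h : l ≠ [], G.Adj (l.getLast h) (l.head h)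

theorem IsHamiltonList.mono (h : G.IsHamiltonList l) (hGH : G ≤ H) : H.IsHamiltonList l :=
  ⟨h.1.mono hGH, h.2.1, h.2.2.imp fun _ hadj => hGH hadj⟩

/-- `G` has a Hamilton cycle or a path with `j` vertices. -/
def HasHamiltonOrPath (G : SimpleGraph V) (j : ℕ) : Prop :=
  (∃ l, G.IsHamiltonList l) ∨ ∃ l, G.IsPathList l ∧ l.length = j

theorem HasHamiltonOrPath.mono {j : ℕ} (h : G.HasHamiltonOrPath j) (hGH : G ≤ H) :
    H.HasHamiltonOrPath j :=
  h.imp (fun ⟨l, hl⟩ => ⟨l, hl.mono hGH⟩) fun ⟨l, hl, hj⟩ => ⟨l, hl.mono hGH, hj⟩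

theorem IsExpander.mono (h : G.IsExpander) (hGH : G ≤ H) : H.IsExpander := by
  refine fun S hS hc => (h S hS hc).trans (Finset.card_le_card fun y hy => ?_)
  rw [mem_outerNeighbors] at hy ⊢
  exact ⟨hy.1, hy.2.imp fun u hu => ⟨hu.1, hGH hu.2⟩⟩

variable [DecidableEq V]

/-- If `l₀` is a longest path, an outer neighbour of its set of rotation ends is next to such an end
on `l₀`. -/
theorem exists_rotationEnd_next (h₀ : G.IsPathList l₀)
    (hmax : ¬ ∃ l, G.IsPathList l ∧ l.length = l₀.length + 1) {y : V}
    (hy : y ∈ G.outerNeighbors (G.rotationEnds l₀)) :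
    ∃ z ∈ G.rotationEnds l₀, z ∈ l₀ ∧ y ∈ l₀ ∧
      (l₀.idxOf y = l₀.idxOf z + 1 ∨ l₀.idxOf z = l₀.idxOf y + 1) := by
  rw [mem_outerNeighbors] at hy
  obtain ⟨hyR, u, hu, huy⟩ := hy
  by_contra! hcon
  set N : V → Prop := fun z => z ∈ l₀ ∧ y ∈ l₀ ∧
    (l₀.idxOf y = l₀.idxOf z + 1 ∨ l₀.idxOf z = l₀.idxOf y + 1) with hN
  have hNR : ∀ z ∈ G.rotationEnds l₀, ¬ N z := by
    rintro z hz ⟨h1, h2, h3⟩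
    have := hcon z hz h1 h2
    tauto
  -- `N` collects the neighbours of `y` on `l₀`. The invariant of rotations is that consecutive
  -- vertices satisfy `R`: the vertices next to `y` on a rotated path are among them.
  set R : V → V → Prop := fun a b => (a = y → N b) ∧ (b = y → N a) with hRdef
  have hRsymm : ∀ ⦃a b⦄, R a b → R b a := fun a b hab => ⟨hab.2, hab.1⟩
  have hlast : ∀ {w : V} {P : List V}, ∃ Q z, w :: P = Q ++ [z] := fun {w P} =>
    ⟨(w :: P).dropLast, (w :: P).getLast (by simp), (List.dropLast_append_getLast _).symm⟩
  -- A rotation with pivot `y` would turn the vertex before `y`, which lies in `N`, into a rotation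
  -- end.
  have hpivot : ∀ {w : V} {P A : List V}, Rotation G l₀ (w :: P ++ y :: A) → G.Adj w y →
      (w :: P ++ y :: A).IsChain R → False := by
    intro w P A hrot hwy hch
    obtain ⟨Q, z, hQ⟩ := @hlast w P
    rw [hQ, List.isChain_append] at hch
    have hR := hch.2.2 z (by simp) y (by simp)
    exact hNR z (mem_rotationEnds.2 ⟨_, hrot.step' hwy hQ⟩) (hR.2 rfl)
  have hinv : ∀ l, Rotation G l₀ l → l.IsChain R := by
    intro l hl
    induction hl with
    | refl =>
      rw [List.isChain_iff_getElem]
      intro i hi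
      have e1 := h₀.1.idxOf_getElem i (by omega)
      have e2 := h₀.1.idxOf_getElem (i + 1) hi
      refine ⟨fun h => ?_, fun h => ?_⟩
      · refine ⟨List.getElem_mem _, h ▸ List.getElem_mem _, Or.inr ?_⟩
        rw [← h, e1, e2]
      · refine ⟨List.getElem_mem _, h ▸ List.getElem_mem _, Or.inl ?_⟩
        rw [← h, e1, e2]
    -- The only new consecutive pair is `w`, `x`. Here `w` is a rotation end, hence not `y`, and `x
    -- = y` is excluded by `hpivot`.
    | @step w x P A hrot hwx ih =>
      refine isChain_rotate hRsymm ih ⟨fun h => ?_, fun h => ?_⟩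
      · exact absurd (mem_rotationEnds.2 ⟨_, hrot⟩) (h ▸ hyR)
      · subst h
        exact (hpivot hrot hwx ih).elim
  obtain ⟨l, hl⟩ := mem_rotationEnds.1 hu
  have hyl : y ∈ u :: l := by
    by_contra hyl
    refine hmax ⟨y :: u :: l, ⟨List.nodup_cons.2 ⟨hyl, (hl.isPathList h₀).1⟩, ?_⟩, ?_⟩
    · exact List.isChain_cons_cons.2 ⟨huy.symm, (hl.isPathList h₀).2⟩
    · rw [List.length_cons, hl.perm.length_eq]
  rcases List.mem_cons.1 hyl with rfl | hyl
  · exact hyR hu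
  · obtain ⟨P, A, rfl⟩ := List.append_of_mem hyl
    exact hpivot (w := u) (P := P) (A := A) hl huy (hinv _ hl)

/-- Pósa's lemma. -/
theorem card_outerNeighbors_rotationEnds_lt (h₀ : G.IsPathList l₀) (hne : l₀ ≠ [])
    (hmax : ¬ ∃ l, G.IsPathList l ∧ l.length = l₀.length + 1) :
    (G.outerNeighbors (G.rotationEnds l₀)).card < 2 * (G.rotationEnds l₀).card := by
  obtain ⟨a, l, rfl⟩ := List.exists_cons_of_ne_nil hne
  have ha : a ∈ G.rotationEnds (a :: l) := mem_rotationEnds.2 ⟨l, .refl⟩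
  set R := G.rotationEnds (a :: l)
  -- Every end accounts for its successor and its predecessor on the path. The first vertex `a` is
  -- an end without predecessor, which makes the final inequality strict.
  have hsub : G.outerNeighbors R ⊆
      R.image (fun z => (a :: l).getD ((a :: l).idxOf z + 1) a) ∪
      (R.erase a).image (fun z => (a :: l).getD ((a :: l).idxOf z - 1) a) := by
    intro y hy
    obtain ⟨z, hz, hzl, hyl, h | h⟩ := exists_rotationEnd_next h₀ hmax hy
    · refine Finset.mem_union_left _ (Finset.mem_image.2 ⟨z, hz, ?_⟩)
      rw [← h, List.getD_eq_getElem _ _ (List.idxOf_lt_length_of_mem hyl), List.getElem_idxOf]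
    · refine Finset.mem_union_right _ (Finset.mem_image.2 ⟨z, Finset.mem_erase.2 ⟨?_, hz⟩, ?_⟩)
      · rintro rfl
        simp at h
      · rw [h, Nat.add_sub_cancel,
          List.getD_eq_getElem _ _ (List.idxOf_lt_length_of_mem hyl), List.getElem_idxOf]
  have h1 := (Finset.card_le_card hsub).trans (Finset.card_union_le _ _)
  have h2 := Finset.card_image_le (s := R) (f := fun z => (a :: l).getD ((a :: l).idxOf z + 1) a)
  have h3 := Finset.card_image_le (s := R.erase a)
    (f := fun z => (a :: l).getD ((a :: l).idxOf z - 1) a)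
  have h4 := Finset.card_erase_of_mem ha
  have h5 : 0 < R.card := Finset.card_pos.2 ⟨a, ha⟩
  omega

/-! ### Boosters -/

/-- A set with too few outer neighbours cannot be closed under adjacency. -/
theorem IsExpander.three_mul_le (h : G.IsExpander) {U : Finset V} (hU : U.Nonempty)
    (hclosed : ∀ z ∈ U, ∀ y, G.Adj z y → y ∈ U) :
    3 * (Fintype.card V / 4) ≤ U.card := by
  by_cases hc : 4 * U.card ≤ Fintype.card V
  · have h1 := h U hU hc
    have h2 : G.outerNeighbors U = ∅ := by
      refine Finset.eq_empty_of_forall_notMem fun y hy => ?_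
      obtain ⟨h3, u, hu, huy⟩ := mem_outerNeighbors.1 hy
      exact h3 (hclosed u hu y huy)
    have := hU.card_pos
    simp [h2] at h1
    simp [h1] at hU
  · obtain ⟨S, hSU, hS⟩ := Finset.exists_subset_card_eq (s := U) (n := Fintype.card V / 4) (by omega)
    rcases S.eq_empty_or_nonempty with rfl | hne
    · rw [← hS]; simp
    have h1 := h S hne (by omega)
    have h2 : G.outerNeighbors S ⊆ U \ S := by
      intro y hy
      obtain ⟨h3, u, hu, huy⟩ := mem_outerNeighbors.1 hy
      exact Finset.mem_sdiff.2 ⟨hclosed u (hSU hu) y huy, h3⟩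
    have h3 := Finset.card_le_card h2
    rw [Finset.card_sdiff_of_subset hSU] at h3
    have := Finset.card_le_card hSU
    omega

/-- Otherwise U and its complement are both closed under adjacency and have at least 3⌊n/4⌋ vertices
each, but 6⌊n/4⌋ > n for n ≥ 12. -/
theorem IsExpander.exists_adj_notMem (h : G.IsExpander) (hn : 12 ≤ Fintype.card V) {U : Finset V}
    (hU : U.Nonempty) (hU' : U ≠ Finset.univ) : ∃ z ∈ U, ∃ y ∉ U, G.Adj z y := by
  by_contra! hcon
  have h1 := h.three_mul_le hU fun z hz y hzy => by
    by_contra hy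
    exact hcon z hz y hy hzy
  have h2 := h.three_mul_le (U := Uᶜ) (Finset.nonempty_iff_ne_empty.2 fun he => hU' (by simpa using he))
    fun z hz y hzy => by
      rw [Finset.mem_compl] at hz ⊢
      exact fun hy => hcon y hy z hz hzy.symm
  rw [Finset.card_compl] at h2
  omega

/-- In a graph containing an expander, a path whose ends are adjacent can be closed to a Hamilton
cycle or prolonged. -/
theorem IsExpander.hasHamiltonOrPath_succ (h : G.IsExpander) (hn : 12 ≤ Fintype.card V)
    (hGH : G ≤ H) (hl : H.IsPathList l) (hne : l ≠ [])
    (hclose : H.Adj (l.getLast hne) (l.head hne)) : H.HasHamiltonOrPath (l.length + 1) := by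
  by_cases hc : l.length = Fintype.card V
  · exact Or.inl ⟨l, hl, hc, hne, hclose⟩
  · obtain ⟨z, hz, y, hy, hzy⟩ := h.exists_adj_notMem hn (U := l.toFinset)
      (by simpa using hne) (fun he => hc (by
        rw [← List.toFinset_card_of_nodup hl.1, he, Finset.card_univ]))
    rw [List.mem_toFinset] at hz hy
    obtain ⟨P, A, rfl⟩ := List.append_of_mem hz
    -- Close the path to a cycle, open it just before `z`, and leave it from `z` to `y`.
    refine Or.inr ⟨y :: (z :: A ++ P), ⟨List.nodup_cons.2 ⟨?_, ?_⟩, ?_⟩, ?_⟩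
    · simpa [or_comm, or_left_comm, and_comm, and_left_comm] using hy
    · exact (List.perm_append_comm.nodup_iff).1 hl.1
    · refine List.isChain_cons_cons.2 ⟨hGH hzy.symm, ?_⟩
      have h1 := hl.2
      rw [List.isChain_append] at h1
      change ((z :: A) ++ P).IsChain _
      rw [List.isChain_append]
      refine ⟨h1.2.1, h1.1, fun a ha b hb => ?_⟩
      have ha' : (P ++ z :: A).getLast hne = a := by
        rw [List.getLast_append_of_ne_nil _ (by simp)]
        exact Option.some_injective _ ((List.getLast?_eq_some_getLast _).symm.trans ha)
      have hb' : (P ++ z :: A).head hne = b := by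
        cases P with
        | nil => simp at hb
        | cons p P => simpa using hb
      rwa [ha', hb'] at hclose
    · simp; omega

/-- An expander without Hamilton cycle has quadratically many pairs of vertices, each of which leads
to a Hamilton cycle or a longer path when it is added to the edges. -/
theorem IsExpander.exists_boosters (h : G.IsExpander) (hn : 12 ≤ Fintype.card V) {j : ℕ}
    (hj : 0 < j) (hG : G.HasHamiltonOrPath j) (hG' : ¬ G.HasHamiltonOrPath (j + 1)) :
    ∃ B : Finset (Sym2 V), Fintype.card V ^ 2 ≤ 32 * B.card ∧
      ∀ e ∈ B, ¬ e.IsDiag ∧ ∀ H, G ≤ H → e ∈ H.edgeSet → H.HasHamiltonOrPath (j + 1) := by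
  classical
  obtain ⟨l₀, hl₀, rfl⟩ := hG.resolve_left fun hH => hG' (Or.inl hH)
  have hmax : ¬ ∃ l, G.IsPathList l ∧ l.length = l₀.length + 1 := fun hl => hG' (Or.inr hl)
  let B : SimpleGraph V :=
    { Adj := fun u w => u ≠ w ∧ ∀ H, G ≤ H → s(u, w) ∈ H.edgeSet →
        H.HasHamiltonOrPath (l₀.length + 1)
      symm := ⟨fun u w huw => ⟨huw.1.symm, fun H hGH hm => huw.2 H hGH (Sym2.eq_swap ▸ hm)⟩⟩
      loopless := ⟨fun u hu => hu.1 rfl⟩ }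
  have hlarge : ∀ l : List V, G.IsPathList l → l.length = l₀.length →
      Fintype.card V ≤ 4 * (G.rotationEnds l).card := by
    intro l hl hlen
    have hne : l ≠ [] := List.ne_nil_of_length_pos (hlen ▸ hj)
    have h1 := card_outerNeighbors_rotationEnds_lt hl hne (hlen ▸ hmax)
    by_contra hc
    have := h (G.rotationEnds l) (Finset.card_pos.1 (by omega)) (by omega)
    omega
  -- This keeps the two ends of a longest path distinct, so that a booster is not a loop.
  have hlen2 : 2 ≤ l₀.length := by
    by_contra hlt
    obtain ⟨v⟩ : Nonempty V := Fintype.card_pos_iff.1 (by omega)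
    have h1 := h {v} (by simp) (by simp; omega)
    obtain ⟨y, hy⟩ := Finset.card_pos.1 (lt_of_lt_of_le (by simp) h1)
    obtain ⟨h2, u, hu, huy⟩ := mem_outerNeighbors.1 hy
    refine hmax ⟨[u, y], ⟨by simpa using huy.ne, by simpa using huy⟩, ?_⟩
    simp; omega
  -- Reversing a path that starts in `u` and rotating it again keeps `u` fixed as last vertex. Each
  -- of the at least n/4 opposite ends `w` forms a booster with `u`.
  have hdeg : ∀ u ∈ G.rotationEnds l₀, Fintype.card V ≤ 4 * B.degree u := by
    intro u hu
    obtain ⟨l, hl⟩ := mem_rotationEnds.1 hu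
    have hpl := hl.isPathList hl₀
    have hlen := hl.perm.length_eq
    have hrev : G.IsPathList (u :: l).reverse := by
      refine ⟨List.nodup_reverse.2 hpl.1, ?_⟩
      rw [List.isChain_reverse]
      exact hpl.2.imp fun _ _ hab => hab.symm
    have hR := hlarge _ hrev (by simpa using hlen)
    refine hR.trans (Nat.mul_le_mul_left 4 ?_)
    rw [← B.card_neighborFinset_eq_degree]
    refine Finset.card_le_card fun w hw => ?_
    rw [mem_neighborFinset]
    obtain ⟨m, hm⟩ := mem_rotationEnds.1 hw
    have hlast := hm.getLast?
    have hmlen := hm.perm.length_eq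
    have hmpl := hm.isPathList hrev
    have hlast' : (w :: m).getLast (by simp) = u := by
      rw [List.getLast?_eq_some_getLast (by simp)] at hlast
      simpa using hlast
    refine ⟨?_, fun H hGH hm' => ?_⟩
    · rintro rfl
      cases m with
      | nil => simp at hmlen; simp at hlen; simp [hmlen] at hlen; omega
      | cons b m =>
        rw [List.getLast_cons (by simp)] at hlast'
        have h1 := hmpl.1
        rw [List.nodup_cons] at h1
        exact h1.1 (hlast' ▸ List.getLast_mem _)
    · have := h.hasHamiltonOrPath_succ hn hGH (hmpl.mono hGH) (by simp)
        (by rw [hlast']; simpa using hm')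
      rwa [hmlen, List.length_reverse, hlen] at this
  refine ⟨B.edgeFinset, ?_, fun e he => ?_⟩
  -- At least n/4 vertices have booster degree at least n/4, so twice the number of boosters is at
  -- least n²/16.
  · have h1 := B.sum_degrees_eq_twice_card_edges
    have h2 : ∑ u ∈ G.rotationEnds l₀, 4 * B.degree u ≤ ∑ u, 4 * B.degree u :=
      Finset.sum_le_sum_of_subset (Finset.subset_univ _)
    have h3 : (G.rotationEnds l₀).card * Fintype.card V ≤
        ∑ u ∈ G.rotationEnds l₀, 4 * B.degree u := by
      simpa using Finset.card_nsmul_le_sum _ _ _ hdeg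
    rw [← Finset.mul_sum (s := Finset.univ), h1] at h2
    have h4 := hlarge l₀ hl₀ rfl
    nlinarith
  · rw [mem_edgeFinset] at he
    refine ⟨B.not_isDiag_of_mem_edgeSet he, ?_⟩
    induction e with
    | h u w => exact he.2

end SimpleGraph

/-! ### Obstructions to expansion -/

namespace SimpleGraph

variable {V : Type*} [DecidableEq V] {G : SimpleGraph V}

/-- A set of vertices in which every nonempty proper subset sends an edge to its complement spans
the edges of a tree. -/
theorem exists_spanning_edges {U : Finset V} (hU : U.Nonempty)
    (h : ∀ W ⊆ U, W.Nonempty → W ≠ U → ∃ a ∈ W, ∃ b ∈ U \ W, G.Adj a b) :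
    ∃ F : Finset (Sym2 V), F.card + 1 = U.card ∧ ∀ e ∈ F, e ∈ G.edgeSet ∧ ∀ v ∈ e, v ∈ U := by
  have key : ∀ k, k + 1 ≤ U.card → ∃ W ⊆ U, W.card = k + 1 ∧ ∃ F : Finset (Sym2 V), F.card = k ∧
      ∀ e ∈ F, e ∈ G.edgeSet ∧ ∀ v ∈ e, v ∈ W := by
    intro k
    induction k with
    | zero =>
      obtain ⟨a, ha⟩ := hU
      exact fun _ => ⟨{a}, by simpa using ha, by simp, ∅, by simp, by simp⟩
    | succ k ih =>
      intro hk
      obtain ⟨W, hWU, hW, F, hF, hFW⟩ := ih (by omega)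
      obtain ⟨a, ha, b, hb, hab⟩ := h W hWU (Finset.card_pos.1 (by omega)) (by rintro rfl; omega)
      rw [Finset.mem_sdiff] at hb
      refine ⟨insert b W, Finset.insert_subset hb.1 hWU, by simp [hb.2, hW],
        insert s(a, b) F, ?_, ?_⟩
      · rw [Finset.card_insert_of_notMem, hF]
        exact fun hm => hb.2 ((hFW _ hm).2 b (Sym2.mem_mk_right a b))
      · intro e he
        rcases Finset.mem_insert.1 he with rfl | he
        · refine ⟨hab, fun v hv => ?_⟩
          rcases Sym2.mem_iff.1 hv with rfl | rfl
          · exact Finset.mem_insert_of_mem ha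
          · exact Finset.mem_insert_self _ _
        · exact ⟨(hFW e he).1, fun v hv => Finset.mem_insert_of_mem ((hFW e he).2 v hv)⟩
  obtain ⟨W, hWU, hW, F, hF, hFW⟩ := key (U.card - 1) (by have := hU.card_pos; omega)
  have := hU.card_pos
  exact ⟨F, by omega, fun e he => ⟨(hFW e he).1, fun v hv => hWU ((hFW e he).2 v hv)⟩⟩

variable [Fintype V]

/-- A graph that is not an expander contains a set `S` whose neighbourhood lies in a set `U` which
is less than three times as large and spans the edges of a tree. -/
theorem exists_obstruction_of_not_isExpander (h : ¬ G.IsExpander) :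
    ∃ S U : Finset V, S ⊆ U ∧ S.Nonempty ∧ 4 * S.card ≤ Fintype.card V ∧ U.card < 3 * S.card ∧
      (∀ z ∈ S, ∀ y ∉ U, ¬ G.Adj z y) ∧
      ∃ F : Finset (Sym2 V), F.card + 1 = U.card ∧ ∀ e ∈ F, e ∈ G.edgeSet ∧ ∀ v ∈ e, v ∈ U := by
  have hex : ∃ k, ∃ S : Finset V, S.card = k ∧ S.Nonempty ∧ 4 * S.card ≤ Fintype.card V ∧
      (G.outerNeighbors S).card < 2 * S.card := by
    unfold IsExpander at h
    push Not at h
    obtain ⟨S, h1, h2, h3⟩ := h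
    exact ⟨_, S, rfl, h1, h2, h3⟩
  classical
  obtain ⟨S, hS, hne, h4, hlt⟩ := Nat.find_spec hex
  have hmin : ∀ S' : Finset V, S' ⊂ S → S'.Nonempty →
      2 * S'.card ≤ (G.outerNeighbors S').card := by
    intro S' hS' hne'
    by_contra! hc
    have hcard := Finset.card_lt_card hS'
    exact Nat.find_min hex (hS ▸ hcard) ⟨S', rfl, hne', by omega, hc⟩
  have hdisj : Disjoint S (G.outerNeighbors S) := by
    rw [Finset.disjoint_left]
    exact fun y hy hy' => (mem_outerNeighbors.1 hy').1 hy
  have hUcard := Finset.card_union_of_disjoint hdisj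
  refine ⟨S, S ∪ G.outerNeighbors S, Finset.subset_union_left, hne, h4, by omega, ?_, ?_⟩
  · intro z hz y hy hzy
    rw [Finset.mem_union, not_or] at hy
    exact hy.2 (mem_outerNeighbors.2 ⟨hy.1, z, hz, hzy⟩)
  · refine exists_spanning_edges (hne.mono Finset.subset_union_left) fun W hWU hW hWne => ?_
    -- Without edges between W and the rest of U, the sets S ∩ W and S \ W have their outer
    -- neighbours in N(S) ∩ W and N(S) \ W. Both are nonempty proper subsets of S by `hside`, so
    -- they expand by minimality, and adding the two bounds gives 2|S| ≤ |N(S)|.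
    by_contra! hcon
    have hno : ∀ a ∈ S ∪ G.outerNeighbors S, ∀ b ∈ S ∪ G.outerNeighbors S, G.Adj a b →
        (a ∈ W ↔ b ∈ W) := by
      intro a ha b hb hab
      constructor
      · intro haW
        by_contra hbW
        exact hcon a haW b (Finset.mem_sdiff.2 ⟨hb, hbW⟩) hab
      · intro hbW
        by_contra haW
        exact hcon b hbW a (Finset.mem_sdiff.2 ⟨ha, haW⟩) hab.symm
    have hside : ∀ w ∈ S ∪ G.outerNeighbors S, ∃ a ∈ S, (a ∈ W ↔ w ∈ W) := by
      intro w hw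
      rcases Finset.mem_union.1 hw with hw' | hw'
      · exact ⟨w, hw', Iff.rfl⟩
      · obtain ⟨_, a, ha, haw⟩ := mem_outerNeighbors.1 hw'
        exact ⟨a, ha, hno a (Finset.mem_union_left _ ha) w hw haw⟩
    obtain ⟨w, hw⟩ := hW
    obtain ⟨a, haS, ha⟩ := hside w (hWU hw)
    obtain ⟨w', hw'U, hw'⟩ := Finset.exists_of_ssubset (hWU.ssubset_of_ne hWne)
    obtain ⟨a', haS', ha'⟩ := hside w' hw'U
    have haW : a ∈ W := ha.2 hw
    have haW' : a' ∉ W := fun h' => hw' (ha'.1 h')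
    have h1 := hmin (S ∩ W) (Finset.inter_subset_left.ssubset_of_ne fun he =>
      haW' (Finset.mem_inter.1 (he.symm ▸ haS')).2) ⟨a, Finset.mem_inter.2 ⟨haS, haW⟩⟩
    have h2 := hmin (S \ W) (Finset.sdiff_subset.ssubset_of_ne fun he =>
      (Finset.mem_sdiff.1 (he.symm ▸ haS)).2 haW) ⟨a', Finset.mem_sdiff.2 ⟨haS', haW'⟩⟩
    have h3 : G.outerNeighbors (S ∩ W) ⊆ G.outerNeighbors S ∩ W := by
      intro y hy
      obtain ⟨hy1, u, hu, huy⟩ := mem_outerNeighbors.1 hy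
      rw [Finset.mem_inter] at hu hy1
      have hyU : y ∈ S ∪ G.outerNeighbors S := by
        by_cases hyS : y ∈ S
        · exact Finset.mem_union_left _ hyS
        · exact Finset.mem_union_right _ (mem_outerNeighbors.2 ⟨hyS, u, hu.1, huy⟩)
      have hyW := (hno u (Finset.mem_union_left _ hu.1) y hyU huy).1 hu.2
      exact Finset.mem_inter.2 ⟨mem_outerNeighbors.2 ⟨fun hyS => hy1 ⟨hyS, hyW⟩, u, hu.1, huy⟩, hyW⟩
    have h4 : G.outerNeighbors (S \ W) ⊆ G.outerNeighbors S \ W := by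
      intro y hy
      obtain ⟨hy1, u, hu, huy⟩ := mem_outerNeighbors.1 hy
      rw [Finset.mem_sdiff] at hu hy1
      have hyU : y ∈ S ∪ G.outerNeighbors S := by
        by_cases hyS : y ∈ S
        · exact Finset.mem_union_left _ hyS
        · exact Finset.mem_union_right _ (mem_outerNeighbors.2 ⟨hyS, u, hu.1, huy⟩)
      have hyW := fun h' => hu.2 ((hno u (Finset.mem_union_left _ hu.1) y hyU huy).2 h')
      exact Finset.mem_sdiff.2 ⟨mem_outerNeighbors.2 ⟨fun hyS => hy1 ⟨hyS, hyW⟩, u, hu.1, huy⟩, hyW⟩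
    have h5 := Finset.card_le_card h3
    have h6 := Finset.card_le_card h4
    have h7 := Finset.card_inter_add_card_sdiff (G.outerNeighbors S) W
    have h8 := Finset.card_inter_add_card_sdiff S W
    omega

end SimpleGraph

/-! ### Random graphs are expanders -/

namespace SimpleGraph

/-- The graph whose edges are the pairs selected by `x`. -/
def edgeGraph {V : Type*} (x : Sym2 V → Bool) : SimpleGraph V := fromEdgeSet {e | x e = true}

theorem edgeGraph_adj {V : Type*} {x : Sym2 V → Bool} {a b : V} :
    (edgeGraph x).Adj a b ↔ x s(a, b) = true ∧ a ≠ b := by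
  simp [edgeGraph]

theorem edgeGraph_mono {V : Type*} {x y : Sym2 V → Bool} (h : x ≤ y) :
    edgeGraph x ≤ edgeGraph y := by
  intro a b hab
  rw [edgeGraph_adj] at hab ⊢
  have h' := h s(a, b)
  rw [hab.1] at h'
  exact ⟨top_le_iff.1 h', hab.2⟩

variable {V : Type*} [DecidableEq V]

/-- The edge probabilities of the binomial random graph: loops never occur. -/
def edgeProb (p : ℝ) (e : Sym2 V) : ℝ := if e.IsDiag then 0 else p

theorem edgeProb_nonneg {p : ℝ} (h : 0 ≤ p) (e : Sym2 V) : 0 ≤ edgeProb p e := by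
  unfold edgeProb; split_ifs <;> simp [h]

theorem edgeProb_le_one {p : ℝ} (h : p ≤ 1) (e : Sym2 V) : edgeProb p e ≤ 1 := by
  unfold edgeProb; split_ifs <;> simp [h]

variable [Fintype V]

theorem bexp_indicator_le_sum {E ι : Type*} [Fintype E] [DecidableEq E] {p : E → ℝ}
    (h0 : ∀ e, 0 ≤ p e) (h1 : ∀ e, p e ≤ 1) (J : Finset ι) {A : Set (E → Bool)}
    {B : ι → Set (E → Bool)} (hA : ∀ x ∈ A, ∃ i ∈ J, x ∈ B i) :
    bexp p (A.indicator 1) ≤ ∑ i ∈ J, bexp p ((B i).indicator 1) := by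
  have := pexp_sum J (fun e => bern (p e)) (fun i => (B i).indicator 1)
  refine le_trans (bexp_mono h0 h1 fun x => ?_) this.le
  have hnn : ∀ i ∈ J, 0 ≤ (B i).indicator (1 : (E → Bool) → ℝ) x :=
    fun i _ => Set.indicator_nonneg (fun _ _ => zero_le_one) x
  by_cases hx : x ∈ A
  · obtain ⟨i, hi, hxi⟩ := hA x hx
    have h2 := Finset.single_le_sum hnn hi
    rw [Set.indicator_of_mem hxi] at h2
    rwa [Set.indicator_of_mem hx]
  · rw [Set.indicator_of_notMem hx]
    exact Finset.sum_nonneg hnn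

/-- The pairs between `S` and the complement of `U`. -/
def crossPairs (S U : Finset V) : Finset (Sym2 V) :=
  (S ×ˢ Uᶜ).image (Function.uncurry Sym2.mk)

theorem mem_crossPairs {S U : Finset V} {e : Sym2 V} :
    e ∈ crossPairs S U ↔ ∃ a ∈ S, ∃ b ∉ U, s(a, b) = e := by
  simp [crossPairs]

theorem card_crossPairs {S U : Finset V} (h : S ⊆ U) :
    (crossPairs S U).card = S.card * (Fintype.card V - U.card) := by
  rw [crossPairs, Finset.card_image_of_injOn, Finset.card_product, Finset.card_compl]
  rintro ⟨a, b⟩ hab ⟨c, d⟩ hcd he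
  simp only [Finset.coe_product, Set.mem_prod, Finset.mem_coe, Finset.mem_compl] at hab hcd
  simp only [Function.uncurry_apply_pair, Sym2.eq_iff] at he
  rcases he with ⟨rfl, rfl⟩ | ⟨rfl, rfl⟩
  · rfl
  · exact absurd (h hab.1) hcd.2

/-- The probability that the pairs in `F` are edges and the pairs between `S` and the complement of
`U` are not. -/
theorem bexp_edges_cross_le {p : ℝ} (h0 : 0 ≤ p) (h1 : p ≤ 1) {S U : Finset V} (h : S ⊆ U)
    {F : Finset (Sym2 V)} (hF : ∀ e ∈ F, ∀ v ∈ e, v ∈ U) :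
    bexp (edgeProb p) (Set.indicator
      {x | (∀ e ∈ F, x e = true) ∧ ∀ e ∈ crossPairs S U, x e = false} 1) ≤
      p ^ F.card * (1 - p) ^ (S.card * (Fintype.card V - U.card)) := by
  rw [bexp_subset_disjoint]
  · have h2 : ∏ e ∈ crossPairs S U, (1 - edgeProb p e) =
        (1 - p) ^ (S.card * (Fintype.card V - U.card)) := by
      rw [← card_crossPairs h, ← Finset.prod_const]
      refine Finset.prod_congr rfl fun e he => ?_
      obtain ⟨a, ha, b, hb, rfl⟩ := mem_crossPairs.1 he
      have : a ≠ b := fun hab => hb (hab ▸ h ha)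
      simp [edgeProb, this]
    rw [h2]
    refine mul_le_mul_of_nonneg_right ?_ (pow_nonneg (sub_nonneg.2 h1) _)
    rw [← Finset.prod_const]
    -- `F` may contain loops, which have probability 0; hence only an inequality.
    refine Finset.prod_le_prod (fun e _ => edgeProb_nonneg h0 e) fun e _ => ?_
    unfold edgeProb; split_ifs <;> simp [h0]
  · rw [Finset.disjoint_left]
    intro e heF he
    obtain ⟨a, ha, b, hb, rfl⟩ := mem_crossPairs.1 he
    exact hb (hF _ heF b (Sym2.mem_mk_right a b))

/-- The pairs of distinct elements of `U`. -/
def innerPairs (U : Finset V) : Finset (Sym2 V) := U.offDiag.image (Function.uncurry Sym2.mk)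

omit [Fintype V] in
theorem mem_innerPairs {U : Finset V} {e : Sym2 V} :
    e ∈ innerPairs U ↔ ¬ e.IsDiag ∧ ∀ v ∈ e, v ∈ U := by
  induction e with
  | h a b =>
    simp only [innerPairs, Finset.mem_image, Finset.mem_offDiag, Prod.exists,
      Function.uncurry_apply_pair, Sym2.eq_iff, Sym2.mk_isDiag_iff, Sym2.mem_iff]
    constructor
    · rintro ⟨c, d, ⟨hc, hd, hcd⟩, ⟨rfl, rfl⟩ | ⟨rfl, rfl⟩⟩
      · exact ⟨hcd, by rintro v (rfl | rfl) <;> assumption⟩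
      · exact ⟨hcd.symm, by rintro v (rfl | rfl) <;> assumption⟩
    · exact fun h => ⟨a, b, ⟨h.2 a (Or.inl rfl), h.2 b (Or.inr rfl), h.1⟩, Or.inl ⟨rfl, rfl⟩⟩

/-- The event that the pairs between `S` and the complement of `U` are no edges and, if `d` holds,
`U` spans at least `|U| - 1` edges. -/
def obstruction (d : Prop) (S U : Finset V) : Set (Sym2 V → Bool) :=
  {x | (∀ e ∈ crossPairs S U, x e = false) ∧
    (d → ∃ F ∈ (innerPairs U).powersetCard (U.card - 1), ∀ e ∈ F, x e = true)}

theorem bexp_obstruction_le {p : ℝ} (h0 : 0 ≤ p) (h1 : p ≤ 1) {S U : Finset V} (h : S ⊆ U)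
    (d : Prop) [Decidable d] :
    bexp (edgeProb p) ((obstruction d S U).indicator 1) ≤
      (if d then ((U.card.choose 2).choose (U.card - 1) : ℝ) * p ^ (U.card - 1) else 1) *
        (1 - p) ^ (S.card * (Fintype.card V - U.card)) := by
  have hp0 := edgeProb_nonneg (V := V) h0
  have hp1 := edgeProb_le_one (V := V) h1
  by_cases hd : d
  · simp only [hd, if_true]
    refine (bexp_indicator_le_sum hp0 hp1 ((innerPairs U).powersetCard (U.card - 1))
      (B := fun F => {x | (∀ e ∈ F, x e = true) ∧ ∀ e ∈ crossPairs S U, x e = false}) ?_).trans ?_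
    · rintro x ⟨hx, hx'⟩
      obtain ⟨F, hF, hxF⟩ := hx' trivial
      exact ⟨F, hF, hxF, hx⟩
    · have : ∀ F ∈ (innerPairs U).powersetCard (U.card - 1), bexp (edgeProb p) (Set.indicator
          {x | (∀ e ∈ F, x e = true) ∧ ∀ e ∈ crossPairs S U, x e = false} 1) ≤
          p ^ (U.card - 1) * (1 - p) ^ (S.card * (Fintype.card V - U.card)) := by
        intro F hF
        rw [Finset.mem_powersetCard] at hF
        rw [← hF.2]
        exact bexp_edges_cross_le h0 h1 h fun e he => (mem_innerPairs.1 (hF.1 he)).2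
      refine (Finset.sum_le_sum this).trans (le_of_eq ?_)
      rw [Finset.sum_const, Finset.card_powersetCard, innerPairs, Sym2.card_image_offDiag,
        nsmul_eq_mul, mul_assoc]
  · simp only [hd, if_false, one_mul]
    have := bexp_edges_cross_le h0 h1 h (F := ∅) (by simp)
    simpa [obstruction, hd] using this

theorem mem_obstruction_of_not_isExpander {x : Sym2 V → Bool} (hx : ¬ (edgeGraph x).IsExpander) :
    ∃ S U : Finset V, S ⊆ U ∧ 1 ≤ S.card ∧ 4 * S.card ≤ Fintype.card V ∧ U.card < 3 * S.card ∧
      ∀ d, x ∈ obstruction d S U := by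
  obtain ⟨S, U, hSU, hS, h4, hU, hcross, F, hF, hFU⟩ := exists_obstruction_of_not_isExpander hx
  refine ⟨S, U, hSU, hS.card_pos, h4, hU, fun d => ⟨fun e he => ?_, fun _ => ⟨F, ?_, fun e he => ?_⟩⟩⟩
  · obtain ⟨a, ha, b, hb, rfl⟩ := mem_crossPairs.1 he
    have := hcross a ha b hb
    rw [edgeGraph_adj] at this
    have hab : a ≠ b := fun hab => hb (hab ▸ hSU ha)
    simpa [hab] using this
  · rw [Finset.mem_powersetCard]
    exact ⟨fun e he => mem_innerPairs.2 ⟨(edgeGraph x).not_isDiag_of_mem_edgeSet (hFU e he).1,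
      (hFU e he).2⟩, by omega⟩
  · have := (hFU e he).1
    induction e with
    | h a b => exact (edgeGraph_adj.1 this).1

end SimpleGraph

/-- The power (k+1)^(2k) from the choice of tree edges is split between the factorials (k+1)! and
k!, each quotient being at most exp(k+1). The factor 2^(k+1) for the choice of S cancels the 2^(-k)
from the number of pairs up to the leading 2. -/
theorem choose_mul_choose_mul_choose_le {p : ℝ} (h0 : 0 ≤ p) (n k s : ℕ) :
    (n.choose (k + 1) : ℝ) * ((k + 1).choose s * (((k + 1).choose 2).choose k * p ^ k)) ≤
      2 * n * (n * p) ^ k * Real.exp (2 * (k + 1)) := by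
  have hk0 : (0 : ℝ) < (k + 1).factorial := by positivity
  have hk1 : (0 : ℝ) < k.factorial := by positivity
  have h1 : (n.choose (k + 1) : ℝ) ≤ n ^ (k + 1) / (k + 1).factorial := Nat.choose_le_pow_div _ _
  have h2 : ((k + 1).choose s : ℝ) ≤ 2 ^ (k + 1) := by exact_mod_cast Nat.choose_le_two_pow _ _
  have h3 : (((k + 1).choose 2).choose k : ℝ) ≤ (((k : ℝ) + 1) ^ 2 / 2) ^ k / k.factorial := by
    refine (Nat.choose_le_pow_div _ _).trans ?_
    gcongr
    rw [Nat.cast_choose_two]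
    push_cast
    nlinarith [(Nat.cast_nonneg k : (0 : ℝ) ≤ k)]
  have h4 : ((k : ℝ) + 1) ^ k / (k + 1).factorial ≤ Real.exp (k + 1) := by
    refine le_trans ?_ (Real.pow_div_factorial_le_exp ((k : ℝ) + 1) (by positivity) (k + 1))
    gcongr
    · simp
    · omega
  have h5 : ((k : ℝ) + 1) ^ k / k.factorial ≤ Real.exp (k + 1) :=
    Real.pow_div_factorial_le_exp ((k : ℝ) + 1) (by positivity) k
  calc (n.choose (k + 1) : ℝ) * ((k + 1).choose s * (((k + 1).choose 2).choose k * p ^ k))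
      ≤ (n ^ (k + 1) / (k + 1).factorial) * (2 ^ (k + 1) *
        ((((k : ℝ) + 1) ^ 2 / 2) ^ k / k.factorial * p ^ k)) := by gcongr
    _ = 2 * n * (n * p) ^ k * ((((k : ℝ) + 1) ^ k / (k + 1).factorial) *
        (((k : ℝ) + 1) ^ k / k.factorial)) := by
      rw [div_pow, mul_pow, ← pow_mul, mul_comm 2 k, pow_mul, sq]
      field_simp
      ring
    _ ≤ 2 * n * (n * p) ^ k * (Real.exp (k + 1) * Real.exp (k + 1)) := by gcongr
    _ = _ := by rw [← Real.exp_add]; ring_nf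

namespace SimpleGraph

/-- A summand of the first moment bound for obstructions with `|S| = r + 1` and `|U| = m`. -/
theorem obstruction_summand_le {p : ℝ} (h0 : 0 ≤ p) (h1 : p ≤ 1) {n r m : ℕ} (hx : 1 ≤ n * p)
    (hm : 0 < m) (hmr : m < 3 * (r + 1)) (hmn : m ≤ n) (hr : p * (r + 1 : ℕ) ≤ 8) :
    (n.choose m : ℝ) * (m.choose (r + 1) * (((m.choose 2).choose (m - 1) : ℝ) * p ^ (m - 1) *
      (1 - p) ^ ((r + 1) * (n - m)))) ≤
      2 * Real.exp 30 * (n * (n * p) * Real.exp (-(n * p))) *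
        (Real.exp 30 * (n * p) ^ 3 * Real.exp (-(n * p))) ^ r := by
  obtain ⟨k, rfl⟩ : ∃ k, m = k + 1 := ⟨m - 1, by omega⟩
  simp only [Nat.add_sub_cancel]
  -- Since m < 3(r+1) and p(r+1) ≤ 8, replacing n - m by n costs at most 3p(r+1)² ≤ 24(r+1) in the
  -- exponent.
  have hpow : (1 - p) ^ ((r + 1) * (n - (k + 1))) ≤
      Real.exp (-(n * p) * (r + 1)) * Real.exp (24 * (r + 1)) := by
    have h2 : (1 - p) ^ ((r + 1) * (n - (k + 1))) ≤
        Real.exp (-p) ^ ((r + 1) * (n - (k + 1))) :=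
      pow_le_pow_left₀ (sub_nonneg.2 h1) (Real.one_sub_le_exp_neg p) _
    refine h2.trans ?_
    rw [← Real.exp_nat_mul, ← Real.exp_add, Real.exp_le_exp]
    push_cast [Nat.cast_sub hmn] at hr ⊢
    have h3 : ((k : ℝ) + 1) ≤ 3 * (r + 1) := by exact_mod_cast hmr.le
    nlinarith [mul_le_mul_of_nonneg_left hr (show (0 : ℝ) ≤ 3 * (r + 1) by positivity),
      mul_le_mul_of_nonneg_left h3 (show (0 : ℝ) ≤ p * (r + 1) by positivity)]
  have hmain := choose_mul_choose_mul_choose_le h0 n k (r + 1)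
  -- The strict inequality m < 3(r+1) matters: for r = 0 only one factor np remains, which log log n
  -- can absorb.
  have hk : (n * p) ^ k ≤ (n * p) ^ (3 * r + 1) := pow_le_pow_right₀ hx (by omega)
  have he : Real.exp (2 * ((k : ℝ) + 1)) ≤ Real.exp (6 * (r + 1)) := by
    rw [Real.exp_le_exp]
    have h3 : ((k : ℝ) + 1) ≤ 3 * (r + 1) := by exact_mod_cast hmr.le
    linarith
  calc (n.choose (k + 1) : ℝ) * ((k + 1).choose (r + 1) * ((((k + 1).choose 2).choose k : ℝ) *
        p ^ k * (1 - p) ^ ((r + 1) * (n - (k + 1)))))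
      = (n.choose (k + 1) : ℝ) * ((k + 1).choose (r + 1) * ((((k + 1).choose 2).choose k : ℝ) *
        p ^ k)) * (1 - p) ^ ((r + 1) * (n - (k + 1))) := by ring
    _ ≤ (2 * n * (n * p) ^ (3 * r + 1) * Real.exp (6 * (r + 1))) *
        (Real.exp (-(n * p) * (r + 1)) * Real.exp (24 * (r + 1))) := by
      refine mul_le_mul (hmain.trans ?_) hpow (pow_nonneg (sub_nonneg.2 h1) _) (by positivity)
      gcongr
    _ = _ := by
      have e1 : Real.exp (6 * ((r : ℝ) + 1)) * Real.exp (24 * (r + 1)) = Real.exp 30 ^ (r + 1) := by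
        rw [← Real.exp_add, ← Real.exp_nat_mul]; push_cast; ring_nf
      have e2 : Real.exp (-(n * p) * ((r : ℝ) + 1)) = Real.exp (-(n * p)) ^ (r + 1) := by
        rw [← Real.exp_nat_mul]; push_cast; ring_nf
      rw [e2]
      calc _ = 2 * n * (n * p) ^ (3 * r + 1) * (Real.exp (6 * ((r : ℝ) + 1)) *
            Real.exp (24 * (r + 1))) * Real.exp (-(n * p)) ^ (r + 1) := by ring
        _ = _ := by rw [e1]; ring

theorem sum_succ_mul_pow_le {a : ℝ} (h0 : 0 ≤ a) (ha : 4 * a ≤ 1) (n : ℕ) :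
    ∑ r ∈ Finset.range n, ((r : ℝ) + 1) * a ^ r ≤ 2 := by
  refine (Finset.sum_le_sum fun r _ => ?_).trans (sum_geometric_two_le n)
  have h1 : (r : ℝ) + 1 ≤ 2 ^ r := by exact_mod_cast r.lt_two_pow_self
  calc ((r : ℝ) + 1) * a ^ r ≤ 2 ^ r * (1 / 4) ^ r := by
        gcongr
        linarith
    _ = (1 / 2) ^ r := by rw [← mul_pow]; norm_num

/-- The sum of the first moment bounds over all small obstructions. -/
theorem sum_obstruction_le {p : ℝ} (h0 : 0 ≤ p) (h1 : p ≤ 1) {n : ℕ} (hx : 1 ≤ n * p)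
    (ha : 4 * (Real.exp 30 * (n * p) ^ 3 * Real.exp (-(n * p))) ≤ 1) :
    ∑ m ∈ Finset.range (n + 1), n.choose m • ∑ s ∈ Finset.range (m + 1), m.choose s •
      (if 1 ≤ s ∧ m < 3 * s ∧ p * s ≤ 8 then ((m.choose 2).choose (m - 1) : ℝ) * p ^ (m - 1) *
        (1 - p) ^ (s * (n - m)) else 0) ≤
      12 * Real.exp 30 * (n * (n * p) * Real.exp (-(n * p))) := by
  set a := Real.exp 30 * (n * p) ^ 3 * Real.exp (-(n * p)) with hadef
  set b := 2 * Real.exp 30 * (n * (n * p) * Real.exp (-(n * p))) with hb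
  have ha0 : 0 ≤ a := by positivity
  have hb0 : 0 ≤ b := by positivity
  have hterm : ∀ m ∈ Finset.range (n + 1), (n.choose m • ∑ s ∈ Finset.range (m + 1), m.choose s •
      (if 1 ≤ s ∧ m < 3 * s ∧ p * s ≤ 8 then ((m.choose 2).choose (m - 1) : ℝ) * p ^ (m - 1) *
        (1 - p) ^ (s * (n - m)) else 0)) ≤
      ∑ r ∈ Finset.range n, if m < 3 * (r + 1) then b * a ^ r else 0 := by
    intro m hm
    rw [Finset.mem_range, Nat.lt_succ_iff] at hm
    rw [Finset.smul_sum, Finset.sum_range_succ']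
    simp only [nsmul_eq_mul]
    norm_num only [Nat.one_le_iff_ne_zero, not_true_eq_false, false_and, if_false, mul_zero, add_zero, ne_eq]
    refine (Finset.sum_le_sum fun r hr => ?_).trans (Finset.sum_le_sum_of_subset_of_nonneg
      (Finset.range_mono hm) fun r _ _ => by split_ifs <;> positivity)
    rw [Finset.mem_range] at hr
    by_cases hc : m < 3 * (r + 1)
    · by_cases hp : p * (r + 1 : ℕ) ≤ 8
      · rw [if_pos ⟨by omega, hc, hp⟩, if_pos hc]
        exact obstruction_summand_le h0 h1 hx (by omega) hc hm hp
      · rw [if_neg (fun h => hp h.2.2), if_pos hc]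
        simp only [mul_zero]; positivity
    · rw [if_neg (fun h => hc h.2.1), if_neg hc]
      simp
  refine (Finset.sum_le_sum hterm).trans ?_
  rw [Finset.sum_comm]
  -- At most 3(r+1) sizes m occur for a given r.
  have hinner : ∀ r ∈ Finset.range n, (∑ m ∈ Finset.range (n + 1),
      if m < 3 * (r + 1) then b * a ^ r else 0) ≤ 3 * b * (((r : ℝ) + 1) * a ^ r) := by
    intro r _
    rw [← Finset.sum_filter, Finset.sum_const, nsmul_eq_mul]
    have hcard : ((Finset.range (n + 1)).filter (fun m => m < 3 * (r + 1))).card ≤ 3 * (r + 1) := by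
      refine (Finset.card_le_card (t := Finset.range (3 * (r + 1))) fun m hm => ?_).trans_eq
        (Finset.card_range _)
      exact Finset.mem_range.2 (Finset.mem_filter.1 hm).2
    have : (((Finset.range (n + 1)).filter (fun m => m < 3 * (r + 1))).card : ℝ) ≤ 3 * (r + 1) := by
      exact_mod_cast hcard
    calc _ ≤ (3 * ((r : ℝ) + 1)) * (b * a ^ r) := by gcongr
      _ = _ := by ring
  refine (Finset.sum_le_sum hinner).trans ?_
  rw [← Finset.mul_sum]
  calc 3 * b * _ ≤ 3 * b * 2 := by
        gcongr
        exact sum_succ_mul_pow_le ha0 ha n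
    _ = _ := by rw [hb]; ring

variable {V : Type*} [DecidableEq V] [Fintype V]

/-- The binomial random graph is an expander except with a small probability. -/
theorem bexp_not_isExpander_le {p : ℝ} (h0 : 0 ≤ p) (h1 : p ≤ 1) {n : ℕ}
    (hn : Fintype.card V = n) (hx : 1 ≤ n * p)
    (ha : 4 * (Real.exp 30 * (n * p) ^ 3 * Real.exp (-(n * p))) ≤ 1) :
    bexp (edgeProb p) (Set.indicator {x : Sym2 V → Bool | ¬ (edgeGraph x).IsExpander} 1) ≤
      12 * Real.exp 30 * (n * (n * p) * Real.exp (-(n * p))) + (4 * Real.exp (-2)) ^ n := by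
  classical
  set w : ℕ → ℕ → ℝ := fun m s => if 1 ≤ s ∧ m < 3 * s ∧ p * s ≤ 8 then
    ((m.choose 2).choose (m - 1) : ℝ) * p ^ (m - 1) * (1 - p) ^ (s * (n - m)) else 0 with hw
  have hw0 : ∀ m s, 0 ≤ w m s := fun m s => by
    have : 0 ≤ 1 - p := sub_nonneg.2 h1
    simp only [hw]; split_ifs <;> positivity
  set J : Finset (Finset V × Finset V) := {c | c.1 ⊆ c.2 ∧ 1 ≤ c.1.card ∧ 4 * c.1.card ≤ n ∧
    c.2.card < 3 * c.1.card} with hJ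
  have hunion := bexp_indicator_le_sum (edgeProb_nonneg (V := V) h0) (edgeProb_le_one h1) J
    (A := {x : Sym2 V → Bool | ¬ (edgeGraph x).IsExpander})
    (B := fun c => obstruction (p * c.1.card ≤ 8) c.1 c.2) (by
      intro x hx
      obtain ⟨S, U, h1, h2, h3, h4, h5⟩ := mem_obstruction_of_not_isExpander hx
      exact ⟨(S, U), by simp [hJ, h1, Finset.card_pos.1 h2, hn ▸ h3, h4], h5 _⟩)
  refine hunion.trans ?_
  have hterm : ∀ c ∈ J, bexp (edgeProb p) ((obstruction (p * c.1.card ≤ 8) c.1 c.2).indicator 1) ≤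
      w c.2.card c.1.card + Real.exp (-2) ^ n := by
    rintro ⟨S, U⟩ hc
    simp only [hJ, Finset.mem_filter, Finset.mem_univ, true_and] at hc
    obtain ⟨hSU, hS, h4, hU⟩ := hc
    refine (bexp_obstruction_le h0 h1 hSU _).trans ?_
    rw [hn]
    by_cases hp : p * S.card ≤ 8
    · simp only [hp, if_true, hw, hS, hU, and_self]
      have := pow_pos (Real.exp_pos (-2)) n
      linarith
    -- For p|S| > 8 the missing pairs alone suffice: |U| < 3|S| ≤ 3n/4, so p|S|(n - |U|) ≥ 2n, and
    -- exp(-2n) beats the at most 4^n choices of (S, U).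
    · simp only [hp, if_false, hw, and_false, one_mul, zero_add]
      have h2 : (1 - p) ^ (S.card * (n - U.card)) ≤ Real.exp (-p) ^ (S.card * (n - U.card)) :=
        pow_le_pow_left₀ (sub_nonneg.2 h1) (Real.one_sub_le_exp_neg p) _
      refine h2.trans ?_
      rw [← Real.exp_nat_mul, ← Real.exp_nat_mul, Real.exp_le_exp]
      have h5 : n ≤ 4 * (n - U.card) := by omega
      have h6 : (n : ℝ) ≤ 4 * ((n - U.card : ℕ) : ℝ) := by exact_mod_cast h5
      rw [Nat.cast_mul]
      push Not at hp
      nlinarith [mul_le_mul_of_nonneg_right hp.le (Nat.cast_nonneg (α := ℝ) (n - U.card))]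
  refine (Finset.sum_le_sum hterm).trans ?_
  rw [Finset.sum_add_distrib]
  have hV : (Finset.univ : Finset V).card = n := by rw [Finset.card_univ, hn]
  refine add_le_add ?_ ?_
  · refine le_trans ?_ (sum_obstruction_le h0 h1 hx ha)
    calc ∑ c ∈ J, w c.2.card c.1.card
        ≤ ∑ c ∈ (Finset.univ : Finset (Finset V × Finset V)).filter (fun c => c.1 ⊆ c.2),
            w c.2.card c.1.card := by
          refine Finset.sum_le_sum_of_subset_of_nonneg (fun c hc => ?_) fun c _ _ => hw0 _ _
          simp only [hJ, Finset.mem_filter, Finset.mem_univ, true_and] at hc ⊢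
          exact hc.1
      _ = ∑ U ∈ (Finset.univ : Finset V).powerset, ∑ S ∈ U.powerset, w U.card S.card := by
          refine (Finset.sum_filter _ _).trans ?_
          rw [Fintype.sum_prod_type, Finset.sum_comm, Finset.powerset_univ]
          refine Finset.sum_congr rfl fun U _ => ?_
          refine (Finset.sum_filter (fun S => S ⊆ U) (fun S => w U.card S.card)).symm.trans ?_
          refine Finset.sum_congr ?_ fun _ _ => rfl
          ext S; simp
      _ = _ := by
          have e : ∀ U : Finset V, ∑ S ∈ U.powerset, w U.card S.card =
              ∑ s ∈ Finset.range (U.card + 1), U.card.choose s • w U.card s := fun U =>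
            Finset.sum_powerset_apply_card (w U.card)
          simp only [e]
          rw [Finset.sum_powerset_apply_card
            (fun m => ∑ s ∈ Finset.range (m + 1), m.choose s • w m s), hV]
  · rw [Finset.sum_const, nsmul_eq_mul]
    have hc : (J.card : ℝ) ≤ 4 ^ n := by
      have : J.card ≤ 4 ^ n := by
        refine (Finset.card_le_univ _).trans_eq ?_
        rw [Fintype.card_prod, Fintype.card_finset, hn, ← mul_pow]
        norm_num
      exact_mod_cast this
    rw [mul_pow]
    gcongr

end SimpleGraph

/-! ### Sprinkling -/

/-- The expectation of `f` after adding a random subset of density `q`. -/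
def sprinkle {E : Type*} [Fintype E] [DecidableEq E] (q : E → ℝ) (f : (E → Bool) → ℝ)
    (x : E → Bool) : ℝ :=
  bexp q (fun y => f (x ⊔ y))

section sprinkle

variable {E : Type*} [Fintype E] [DecidableEq E] {p q : E → ℝ}

theorem bexp_const_add_mul (p : E → ℝ) (a b : ℝ) (f : (E → Bool) → ℝ) :
    bexp p (fun y => a + b * f y) = a + b * bexp p f := by
  have := bexp_const p a
  rw [bexp] at this ⊢
  rw [pexp_add, pexp_const_mul, this, bexp]

/-- By `bexp_or` all rounds merge into one random set, whose density is at most the sum of the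
densities. -/
theorem exists_bexp_sprinkle_iterate (hp0 : ∀ e, 0 ≤ p e) (hp1 : ∀ e, p e ≤ 1)
    (hq0 : ∀ e, 0 ≤ q e) (hq1 : ∀ e, q e ≤ 1) (L : ℕ) :
    ∃ r : E → ℝ, (∀ e, 0 ≤ r e ∧ r e ≤ p e + L * q e) ∧
      ∀ f, bexp p ((sprinkle q)^[L] f) = bexp r f := by
  suffices ∃ r : E → ℝ, (∀ e, 0 ≤ r e ∧ r e ≤ p e + L * q e ∧ r e ≤ 1) ∧
      ∀ f, bexp p ((sprinkle q)^[L] f) = bexp r f by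
    obtain ⟨r, hr, h⟩ := this
    exact ⟨r, fun e => ⟨(hr e).1, (hr e).2.1⟩, h⟩
  induction L with
  | zero => exact ⟨p, fun e => ⟨hp0 e, by simp, hp1 e⟩, fun f => rfl⟩
  | succ L ih =>
    obtain ⟨r, hr, h⟩ := ih
    refine ⟨fun e => r e + q e - r e * q e, fun e => ?_, fun f => ?_⟩
    · obtain ⟨h1, h2, h3⟩ := hr e
      have := hq0 e
      have := hq1 e
      push_cast
      refine ⟨?_, ?_, ?_⟩ <;> nlinarith
    · rw [Function.iterate_succ_apply, h, ← bexp_or]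
      rfl

theorem sprinkle_iterate_le_const (hq0 : ∀ e, 0 ≤ q e) (hq1 : ∀ e, q e ≤ 1)
    {f : (E → Bool) → ℝ} {c : ℝ} {A : Set (E → Bool)} (hA : ∀ x ∈ A, ∀ y, x ≤ y → y ∈ A)
    (h : ∀ x ∈ A, f x ≤ c) (L : ℕ) : ∀ x ∈ A, (sprinkle q)^[L] f x ≤ c := by
  induction L with
  | zero => exact h
  | succ L ih =>
    intro x hx
    rw [Function.iterate_succ_apply']
    exact (bexp_mono hq0 hq1 fun y => ih _ (hA x hx _ le_sup_left)).trans_eq (bexp_const q c)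

end sprinkle

namespace SimpleGraph

variable {V : Type*} [DecidableEq V] [Fintype V]

/-- The selections of pairs whose graph has no Hamilton cycle. -/
def nonHamiltonian (V : Type*) [Fintype V] : Set (Sym2 V → Bool) :=
  {x | ¬ ∃ l, (edgeGraph x).IsHamiltonList l}

omit [DecidableEq V] in
theorem nonHamiltonian_of_le {x y : Sym2 V → Bool} (h : x ≤ y) (hy : y ∈ nonHamiltonian V) :
    x ∈ nonHamiltonian V :=
  fun ⟨l, hl⟩ => hy ⟨l, hl.mono (edgeGraph_mono h)⟩

omit [DecidableEq V] in
theorem antitone_indicator_nonHamiltonian :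
    Antitone ((nonHamiltonian V).indicator (1 : (Sym2 V → Bool) → ℝ)) := by
  intro x y h
  by_cases hy : y ∈ nonHamiltonian V
  · rw [Set.indicator_of_mem hy, Set.indicator_of_mem (nonHamiltonian_of_le h hy)]
    rfl
  · rw [Set.indicator_of_notMem hy]
    exact Set.indicator_nonneg (fun _ _ => zero_le_one) x

/-- The probability that an expander which has a path with `j` vertices has no Hamilton cycle after
`L` rounds of sprinkling. -/
theorem sprinkle_nonHamiltonian_le (hn : 12 ≤ Fintype.card V) {q : ℝ} (hq0 : 0 ≤ q) (hq1 : q ≤ 1)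
    (hq : 96 ≤ q * (Fintype.card V : ℝ) ^ 2) (L : ℕ) :
    ∀ d j, j + d = Fintype.card V + 1 → 0 < j → ∀ x : Sym2 V → Bool, (edgeGraph x).IsExpander →
      (edgeGraph x).HasHamiltonOrPath j →
      (sprinkle (edgeProb q))^[L] ((nonHamiltonian V).indicator 1) x ≤ 16 ^ d * (1 / 8) ^ L := by
  have hp0 := edgeProb_nonneg (V := V) hq0
  have hp1 := edgeProb_le_one (V := V) hq1
  induction L with
  | zero =>
    intro d j _ _ x _ hx
    by_cases hH : x ∈ nonHamiltonian V
    · rw [Function.iterate_zero, id, Set.indicator_of_mem hH]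
      simpa using one_le_pow₀ (by norm_num : (1 : ℝ) ≤ 16)
    · rw [Function.iterate_zero, id, Set.indicator_of_notMem hH]
      positivity
  | succ L ihL =>
    intro d
    induction d with
    | zero =>
      intro j hj _ x _ hx
      -- Here j = n + 1, too long for a path.
      have hH : ∃ l, (edgeGraph x).IsHamiltonList l := by
        refine hx.resolve_right ?_
        rintro ⟨l, hl, hlen⟩
        have := hl.1.length_le_card
        omega
      refine (sprinkle_iterate_le_const hp0 hp1 (c := 0)
        (A := {x | ∃ l, (edgeGraph x).IsHamiltonList l}) ?_ ?_ (L + 1) x hH).trans (by positivity)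
      · rintro x ⟨l, hl⟩ y hxy
        exact ⟨l, hl.mono (edgeGraph_mono hxy)⟩
      · intro x hx
        rw [Set.indicator_of_notMem (not_not_intro hx)]
    | succ d ihd =>
      intro j hj hj0 x hexp hx
      by_cases hx' : (edgeGraph x).HasHamiltonOrPath (j + 1)
      · refine (ihd (j + 1) (by omega) (by omega) x hexp hx').trans ?_
        gcongr
        · norm_num
        · omega
      · obtain ⟨B, hB, hBe⟩ := hexp.exists_boosters hn hj0 hx hx'
        rw [Function.iterate_succ_apply']
        set g := (sprinkle (edgeProb q))^[L] ((nonHamiltonian V).indicator 1)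
        set D : Set (Sym2 V → Bool) :=
          {y | (∀ e ∈ (∅ : Finset (Sym2 V)), y e = true) ∧ ∀ e ∈ B, y e = false} with hD
        -- Unless the round misses all boosters (event `D`), d drops by one. As `D` has probability
        -- at most 1/16, both terms contribute at most 16^d · 8^(-L), and their sum is 16^(d+1) ·
        -- 8^(-(L+1)).
        have hpt : ∀ y, g (x ⊔ y) ≤ 16 ^ d * (1 / 8) ^ L +
            16 ^ (d + 1) * (1 / 8) ^ L * D.indicator 1 y := by
          intro y
          have hle := edgeGraph_mono (le_sup_left : x ≤ x ⊔ y)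
          by_cases hy : y ∈ D
          · rw [Set.indicator_of_mem hy, Pi.one_apply, mul_one]
            refine (ihL (d + 1) j hj hj0 _ (hexp.mono hle) (hx.mono hle)).trans ?_
            exact le_add_of_nonneg_left (by positivity)
          · rw [Set.indicator_of_notMem hy, mul_zero, add_zero]
            obtain ⟨e, heB, he⟩ : ∃ e ∈ B, y e = true := by
              by_contra! hc
              exact hy ⟨by simp, fun e he => by simpa using hc e he⟩
            refine ihL d (j + 1) (by omega) (by omega) _ (hexp.mono hle)
              ((hBe e heB).2 _ hle ?_)
            have hdiag := (hBe e heB).1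
            induction e with
            | h a b =>
              rw [mem_edgeSet, edgeGraph_adj]
              exact ⟨by simp [he], by simpa using hdiag⟩
        refine (bexp_mono hp0 hp1 hpt).trans ?_
        have h1 : bexp (edgeProb q) (fun y => 16 ^ d * (1 / 8) ^ L +
            16 ^ (d + 1) * (1 / 8) ^ L * D.indicator 1 y) = 16 ^ d * (1 / 8) ^ L +
            16 ^ (d + 1) * (1 / 8) ^ L * bexp (edgeProb q) (D.indicator 1) :=
          bexp_const_add_mul _ _ _ _
        -- There are at least n²/32 boosters, so q|B| ≥ 3, and exp(-3) < 1/16.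
        have h2 : bexp (edgeProb q) (D.indicator 1) ≤ 1 / 16 := by
          rw [hD, bexp_subset_disjoint _ _ _ (by simp)]
          have h3 : ∀ e ∈ B, 1 - edgeProb q e = 1 - q := fun e he => by
            simp [edgeProb, (hBe e he).1]
          rw [Finset.prod_empty, one_mul, Finset.prod_congr rfl h3, Finset.prod_const]
          have h4 : (1 - q) ^ B.card ≤ Real.exp (-q) ^ B.card :=
            pow_le_pow_left₀ (sub_nonneg.2 hq1) (Real.one_sub_le_exp_neg q) _
          have h5 : Real.exp (-q) ^ B.card ≤ Real.exp (-1) ^ 3 := by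
            rw [← Real.exp_nat_mul, ← Real.exp_nat_mul, Real.exp_le_exp]
            have h6 : (Fintype.card V : ℝ) ^ 2 ≤ 32 * B.card := by exact_mod_cast hB
            push_cast
            nlinarith [mul_le_mul_of_nonneg_left h6 hq0]
          have h7 : Real.exp (-1) < 0.37 := Real.exp_neg_one_lt_d9.trans (by norm_num)
          have h8 : Real.exp (-1) ^ 3 ≤ 0.37 ^ 3 := pow_le_pow_left₀ (Real.exp_pos _).le h7.le 3
          norm_num at h8
          linarith
        rw [h1, pow_succ, pow_succ]
        have h9 : (0 : ℝ) ≤ 16 ^ d * (1 / 8) ^ L := by positivity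
        nlinarith

/-- The probability that the binomial random graph has no Hamilton cycle, in terms of the probability
that a slightly sparser random graph is not an expander. -/
theorem bexp_nonHamiltonian_le (hn : 12 ≤ Fintype.card V) {p₁ q p : ℝ} (hp₁ : 0 ≤ p₁)
    (hq0 : 0 ≤ q) (hq : 96 ≤ q * (Fintype.card V : ℝ) ^ 2)
    (hp : p₁ + (2 * Fintype.card V : ℕ) * q ≤ p) (hp1 : p ≤ 1) :
    bexp (edgeProb p) ((nonHamiltonian V).indicator 1) ≤
      bexp (edgeProb p₁) (Set.indicator {x : Sym2 V → Bool | ¬ (edgeGraph x).IsExpander} 1) +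
        (1 / 4) ^ Fintype.card V := by
  have hc : (1 : ℝ) ≤ (2 * Fintype.card V : ℕ) := by exact_mod_cast (by omega)
  have hp₁1 : p₁ ≤ 1 := by nlinarith
  have hq1 : q ≤ 1 := by nlinarith
  have hq0' := edgeProb_nonneg (V := V) hq0
  have hq1' := edgeProb_le_one (V := V) hq1
  obtain ⟨r, hr, hrf⟩ := exists_bexp_sprinkle_iterate (edgeProb_nonneg (V := V) hp₁)
    (edgeProb_le_one hp₁1) hq0' hq1' (2 * Fintype.card V)
  have h1 : bexp (edgeProb p) ((nonHamiltonian V).indicator 1) ≤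
      bexp r ((nonHamiltonian V).indicator 1) := by
    refine bexp_antitone antitone_indicator_nonHamiltonian (fun e => (hr e).1) (fun e => ?_)
      (edgeProb_le_one hp1)
    refine (hr e).2.trans ?_
    unfold edgeProb
    split_ifs
    · simp
    · exact hp
  refine h1.trans ?_
  rw [← hrf]
  have hpt : ∀ x : Sym2 V → Bool, (sprinkle (edgeProb q))^[2 * Fintype.card V]
      ((nonHamiltonian V).indicator 1) x ≤
      Set.indicator {x : Sym2 V → Bool | ¬ (edgeGraph x).IsExpander} 1 x +
        (1 / 4) ^ Fintype.card V := by
    intro x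
    by_cases hx : (edgeGraph x).IsExpander
    · rw [Set.indicator_of_notMem (not_not_intro hx), zero_add]
      obtain ⟨v⟩ : Nonempty V := Fintype.card_pos_iff.1 (by omega)
      -- Starting from a single vertex, d = n and L = 2n give 16^n / 8^(2n) = 4^(-n).
      refine (sprinkle_nonHamiltonian_le hn hq0 hq1 hq _ (Fintype.card V) 1 (by omega) one_pos x hx
        (Or.inr ⟨[v], ⟨by simp, by simp⟩, rfl⟩)).trans_eq ?_
      rw [pow_mul, ← mul_pow]
      norm_num
    · rw [Set.indicator_of_mem (show x ∈ {x | ¬ (edgeGraph x).IsExpander} from hx)]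
      have h2 := sprinkle_iterate_le_const hq0' hq1' (f := (nonHamiltonian V).indicator 1) (c := 1)
        (A := Set.univ) (by simp) (fun y _ => Set.indicator_le_self' (by simp) y)
        (2 * Fintype.card V) x (Set.mem_univ x)
      have h3 : (0 : ℝ) ≤ (1 / 4) ^ Fintype.card V := by positivity
      simp only [Pi.one_apply]
      linarith
  refine (bexp_mono (edgeProb_nonneg hp₁) (edgeProb_le_one hp₁1) hpt).trans_eq ?_
  have := bexp_const (edgeProb (V := V) p₁) ((1 / 4) ^ Fintype.card V)
  rw [bexp] at this ⊢
  rw [pexp_add, this]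
  rfl

end SimpleGraph

/-! ### The threshold for Hamilton cycles -/

namespace SimpleGraph

theorem bexp_indicator_nonneg {E : Type*} [Fintype E] [DecidableEq E] {p : E → ℝ}
    (h0 : ∀ e, 0 ≤ p e) (h1 : ∀ e, p e ≤ 1) (A : Set (E → Bool)) :
    0 ≤ bexp p (A.indicator 1) :=
  (bexp_const p 0).symm.le.trans
    (bexp_mono h0 h1 fun x => Set.indicator_nonneg (fun _ _ => zero_le_one) x)

/-- The binomial random graph with `n` vertices and edge probability
`(log n + log log n + ω(n)) / n` is almost surely Hamiltonian if `ω → ∞`. -/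
theorem tendsto_bexp_nonHamiltonian {ω p : ℕ → ℝ} (hω : Tendsto ω atTop atTop)
    (hp : ∀ n : ℕ, p n = (Real.log n + Real.log (Real.log n) + ω n) / n)
    (hp1 : ∀ᶠ n in atTop, p n ≤ 1) :
    Tendsto (fun n => bexp (edgeProb (p n)) ((nonHamiltonian (Fin n)).indicator 1)) atTop (𝓝 0) := by
  have hlog : Tendsto (fun n : ℕ => Real.log n) atTop atTop :=
    Real.tendsto_log_atTop.comp tendsto_natCast_atTop_atTop
  have hll : Tendsto (fun n : ℕ => Real.log (Real.log n)) atTop atTop :=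
    Real.tendsto_log_atTop.comp hlog
  -- Truncating ω at log log n ensures y ≤ 3 log n below. Half of w goes into the expander density
  -- y/n; the other half is spread over 2n rounds of density w/(4n²), and w ≥ 384 gives the required
  -- w/4 ≥ 96.
  set w : ℕ → ℝ := fun n => min (ω n) (Real.log (Real.log n)) with hw
  have hwt : Tendsto w atTop atTop := by
    rw [tendsto_atTop] at hω hll ⊢
    intro b
    filter_upwards [hω b, hll b] with n h1 h2 using le_min h1 h2
  set y : ℕ → ℝ := fun n => Real.log n + Real.log (Real.log n) + w n / 2 with hy
  have hyt : Tendsto y atTop atTop :=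
    (hlog.atTop_add_atTop hll).atTop_add_atTop (hwt.atTop_div_const two_pos)
  have hcube : Tendsto (fun n => 4 * (Real.exp 30 * y n ^ 3 * Real.exp (-(y n)))) atTop (𝓝 0) := by
    have h1 := ((Real.tendsto_pow_mul_exp_neg_atTop_nhds_zero 3).comp hyt).const_mul
      (4 * Real.exp 30)
    rw [mul_zero] at h1
    refine h1.congr fun n => ?_
    simp only [Function.comp]
    ring
  have hexp : Tendsto (fun n => 12 * Real.exp 30 * (3 * Real.exp (-(w n / 2)))) atTop (𝓝 0) := by
    have h1 := ((Real.tendsto_exp_neg_atTop_nhds_zero.comp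
      (hwt.atTop_div_const two_pos)).const_mul 3).const_mul (12 * Real.exp 30)
    simpa using h1
  have he2 : 4 * Real.exp (-2) < 1 := by
    have h7 : Real.exp (-1) < 0.37 := Real.exp_neg_one_lt_d9.trans (by norm_num)
    have h8 : Real.exp (-2) = Real.exp (-1) ^ 2 := by rw [← Real.exp_nat_mul]; norm_num
    have h9 : Real.exp (-1) ^ 2 ≤ 0.37 ^ 2 := pow_le_pow_left₀ (Real.exp_pos _).le h7.le 2
    norm_num at h9
    linarith
  have hbound : Tendsto (fun n => 12 * Real.exp 30 * (3 * Real.exp (-(w n / 2))) +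
      (4 * Real.exp (-2)) ^ n + (1 / 4) ^ n) atTop (𝓝 0) := by
    have h1 := tendsto_pow_atTop_nhds_zero_of_lt_one (by positivity) he2
    have h2 := tendsto_pow_atTop_nhds_zero_of_lt_one (r := (1 / 4 : ℝ)) (by norm_num) (by norm_num)
    simpa using (hexp.add h1).add h2
  have hmain : ∀ᶠ n : ℕ in atTop,
      0 ≤ bexp (edgeProb (p n)) ((nonHamiltonian (Fin n)).indicator 1) ∧
      bexp (edgeProb (p n)) ((nonHamiltonian (Fin n)).indicator 1) ≤
        12 * Real.exp 30 * (3 * Real.exp (-(w n / 2))) + (4 * Real.exp (-2)) ^ n + (1 / 4) ^ n := by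
    filter_upwards [hp1, eventually_ge_atTop 12, hwt.eventually_ge_atTop 384,
      hyt.eventually_ge_atTop 1, hcube.eventually_le_const one_pos, hlog.eventually_ge_atTop 1]
      with n hpn hn hwn hyn hcn hLn
    have hn0 : (0 : ℝ) < n := by exact_mod_cast (by omega : 0 < n)
    have hlln : w n ≤ Real.log (Real.log n) := min_le_right _ _
    have hll' : Real.log (Real.log n) ≤ Real.log n := Real.log_le_self (by linarith)
    have hnp : n * (y n / n) = y n := by field_simp
    have hp₁0 : 0 ≤ y n / n := div_nonneg (by linarith) hn0.le
    have hsum : y n / n + (2 * n : ℕ) * (w n / (4 * n ^ 2)) ≤ p n := by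
      have : y n / n + (2 * n : ℕ) * (w n / (4 * n ^ 2)) =
          (Real.log n + Real.log (Real.log n) + w n) / n := by
        simp only [hy]; push_cast; field_simp; ring
      rw [this, hp]
      gcongr
      exact min_le_left _ _
    have hq0 : 0 ≤ w n / (4 * (n : ℝ) ^ 2) := div_nonneg (by linarith) (by positivity)
    have hp0 : 0 ≤ p n := le_trans (add_nonneg hp₁0 (mul_nonneg (Nat.cast_nonneg _) hq0)) hsum
    have hp₁1 : y n / n ≤ 1 :=
      le_trans (le_add_of_nonneg_right (mul_nonneg (Nat.cast_nonneg _) hq0)) (hsum.trans hpn)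
    have h1 := bexp_nonHamiltonian_le (V := Fin n) (p₁ := y n / n) (q := w n / (4 * n ^ 2))
      (p := p n) (by simpa using hn) hp₁0 hq0
      (by rw [Fintype.card_fin, div_mul_eq_mul_div, le_div_iff₀ (by positivity)]; nlinarith [sq_nonneg (n : ℝ)])
      (by rw [Fintype.card_fin]; exact hsum) hpn
    have h2 := bexp_not_isExpander_le (V := Fin n) hp₁0 hp₁1 (Fintype.card_fin n)
      (by rw [hnp]; exact hyn) (by rw [hnp]; exact hcn)
    rw [hnp] at h2
    rw [Fintype.card_fin] at h1
    have h3 : n * y n * Real.exp (-(y n)) ≤ 3 * Real.exp (-(w n / 2)) := by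
      have e1 : Real.exp (-(y n)) = Real.exp (-(w n / 2)) / (n * Real.log n) := by
        rw [show -(y n) = -(w n / 2) - (Real.log n + Real.log (Real.log n)) by simp only [hy]; ring,
          Real.exp_sub, Real.exp_add, Real.exp_log hn0, Real.exp_log (by linarith)]
      have e2 : y n ≤ 3 * Real.log n := by simp only [hy]; linarith
      rw [e1]
      calc n * y n * (Real.exp (-(w n / 2)) / (n * Real.log n))
          ≤ n * (3 * Real.log n) * (Real.exp (-(w n / 2)) / (n * Real.log n)) := by gcongr
        _ = _ := by field_simp
    refine ⟨bexp_indicator_nonneg (edgeProb_nonneg hp0) (edgeProb_le_one hpn) _, ?_⟩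
    have h4 := mul_le_mul_of_nonneg_left h3 (by positivity : 0 ≤ 12 * Real.exp 30)
    linarith
  exact tendsto_of_tendsto_of_tendsto_of_le_of_le' tendsto_const_nhds hbound
    (hmain.mono fun _ h => h.1) (hmain.mono fun _ h => h.2)

end SimpleGraph

/-! ### Hamilton cycles as sequences of edges -/

namespace SimpleGraph

/-- The sequences of edges `{v 0, v 1}, …, {v (n - 1), v 0}` for injective `v`. -/
def cyclePatterns (n : ℕ) : Set (Fin n → Sym2 (Fin n)) :=
  {τ | ∃ v : Fin n → Fin n, Function.Injective v ∧ τ = fun i => s(v i, v (finRotate n i))}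

theorem cyclePatterns_injective {n : ℕ} (hn : 3 ≤ n) {τ : Fin n → Sym2 (Fin n)}
    (hτ : τ ∈ cyclePatterns n) : Function.Injective τ := by
  obtain ⟨m, rfl⟩ : ∃ m, n = m + 3 := ⟨n - 3, by omega⟩
  obtain ⟨v, hv, rfl⟩ := hτ
  intro i j hij
  simp only [Sym2.eq_iff, finRotate_apply] at hij
  rcases hij with h | h
  · exact hv h.1
  -- Equality with swapped ends means i = j + 1 and j = i + 1, hence 2 = 0 modulo n, impossible for
  -- n ≥ 3.
  · have h1 := hv h.1
    have h2 := hv h.2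
    rw [h1, add_assoc, add_eq_left] at h2
    have h3 := congrArg Fin.val h2
    simp [Fin.val_add, Nat.mod_eq_of_lt] at h3

theorem not_isDiag_of_mem_cyclePatterns {n : ℕ} (hn : 2 ≤ n) {τ : Fin n → Sym2 (Fin n)}
    (hτ : τ ∈ cyclePatterns n) (i : Fin n) : ¬ (τ i).IsDiag := by
  obtain ⟨m, rfl⟩ : ∃ m, n = m + 2 := ⟨n - 2, by omega⟩
  obtain ⟨v, hv, rfl⟩ := hτ
  rw [Sym2.mk_isDiag_iff, hv.eq_iff, finRotate_apply, left_eq_add]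
  exact one_ne_zero

theorem exists_cyclePattern_of_isHamiltonList {n : ℕ} {x : Sym2 (Fin n) → Bool} {l : List (Fin n)}
    (hl : (edgeGraph x).IsHamiltonList l) : ∃ τ ∈ cyclePatterns n, ∀ i, x (τ i) = true := by
  obtain ⟨⟨hnd, hch⟩, hlen, hne, hclose⟩ := hl
  rw [Fintype.card_fin] at hlen
  refine ⟨_, ⟨fun i => l[(i : ℕ)]'(by omega), fun i j hij => ?_, rfl⟩, fun i => ?_⟩
  · exact Fin.ext (hnd.getElem_inj_iff.1 hij)
  suffices ∀ j, finRotate n i = j →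
      (edgeGraph x).Adj (l[(i : ℕ)]'(by omega)) (l[(j : ℕ)]'(by omega)) from
    (edgeGraph_adj.1 (this _ rfl)).1
  rintro j rfl
  rw [List.isChain_iff_getElem] at hch
  have hrot : (finRotate n i : ℕ) = (i + 1) % n := by
    have := i.neZero
    rw [finRotate_apply, Fin.val_add, Fin.val_one', Nat.add_mod_mod]
  by_cases hi : (i : ℕ) + 1 < n
  · simp only [hrot, Nat.mod_eq_of_lt hi]
    exact hch i (by omega)
  · have h1 : (i : ℕ) = l.length - 1 := by omega
    have h2 : (i : ℕ) + 1 = n := by omega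
    rw [List.getLast_eq_getElem, List.head_eq_getElem] at hclose
    have h3 : (finRotate n i : ℕ) = 0 := by rw [hrot, h2, Nat.mod_self]
    simp only [h3, h1]
    exact hclose

/-- A sequence of edges of the right colours around a cycle through all vertices gives a coloured
Hamilton cycle. -/
theorem hasColouredHamiltonCycle_of_cyclePattern {n k : ℕ} (hn : 3 ≤ n) {c : Fin n → Fin k}
    {G : SimpleGraph (Fin n)} {χ : Sym2 (Fin n) → Fin k} {τ : Fin n → Sym2 (Fin n)}
    (hτ : τ ∈ cyclePatterns n) (hG : ∀ i, τ i ∈ G.edgeSet) (hχ : ∀ i, χ (τ i) = c i) :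
    HasColouredHamiltonCycle c G χ := by
  have hinj := cyclePatterns_injective hn hτ
  obtain ⟨v, hv, rfl⟩ := hτ
  have hn0 : 0 < n := by omega
  -- The n-periodic extension of `v`; the closed walk is f 0, …, f n = f 0.
  set f : ℕ → Fin n := fun i => v ⟨i % n, Nat.mod_lt i hn0⟩ with hf
  have hrot : ∀ i : ℕ, f (i + 1) = v (finRotate n ⟨i % n, Nat.mod_lt i hn0⟩) := by
    intro i
    have : NeZero n := ⟨by omega⟩
    simp only [hf, finRotate_apply]
    congr 1
    ext
    simp [Fin.val_add]
  have hadj : ∀ i, G.Adj (f i) (f (i + 1)) := by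
    intro i
    rw [hrot]
    exact hG _
  set l := (List.range (n + 1)).map f with hl
  have hne : l ≠ [] := by simp [hl]
  have hch : l.IsChain G.Adj := by
    rw [List.isChain_iff_getElem]
    intro i hi
    simpa [hl] using hadj i
  have hhead : l.head hne = f 0 := by
    rw [List.head_eq_getElem]
    simp [hl]
  have hlast : l.getLast hne = f 0 := by
    rw [List.getLast_eq_getElem]
    simp [hl, hf]
  set w : G.Walk (f 0) (f 0) := (Walk.ofSupport l hne hch).copy hhead hlast with hw
  have hsupp : w.support = l := by rw [hw, Walk.support_copy, Walk.support_ofSupport]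
  have hedges : w.edges = List.ofFn fun i => s(v i, v (finRotate n i)) := by
    rw [Walk.edges_eq_zipWith_support, hsupp]
    refine List.ext_getElem (by simp [hl]) fun i h1 h2 => ?_
    have hi : i < n := by simpa using h2
    simp only [hl, List.getElem_zipWith, List.getElem_tail, List.getElem_map, List.getElem_range,
      List.getElem_ofFn, hrot]
    simp [hf, Nat.mod_eq_of_lt hi]
  have hlen : w.length = n := by
    have := w.length_support
    rw [hsupp] at this
    simp [hl] at this
    exact this.symm
  refine ⟨f 0, w, ?_, ?_⟩
  · rw [Walk.isHamiltonianCycle_iff_isCycle_and_length_eq, Fintype.card_fin]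
    refine ⟨?_, hlen⟩
    rw [Walk.isCycle_def, Walk.isTrail_def, hedges, hsupp]
    refine ⟨List.nodup_ofFn.2 hinj, fun h => ?_, ?_⟩
    · rw [h] at hlen
      simp at hlen
      omega
    · have : l.tail = (List.range n).map fun i => f (i + 1) := by
        rw [hl, List.range_succ_eq_map]
        simp [Function.comp_def]
      rw [this]
      refine List.Nodup.map_on (fun i hi j hj hij => ?_) List.nodup_range
      rw [List.mem_range] at hi hj
      rw [hrot, hrot] at hij
      have := congrArg Fin.val ((finRotate n).injective (hv hij))
      simpa [Nat.mod_eq_of_lt hi, Nat.mod_eq_of_lt hj] using this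
  · rw [hedges, List.map_ofFn]
    congr 1
    funext i
    exact hχ i

end SimpleGraph

/-! ### The law of the random coloured graph -/

theorem measureReal_pi_eq_pexp {E Ω : Type*} [Fintype E] [DecidableEq E] [Fintype Ω]
    [MeasurableSpace Ω] [MeasurableSingletonClass Ω] (m : E → Measure Ω)
    [∀ e, IsProbabilityMeasure (m e)] (B : Set (E → Ω)) :
    (Measure.pi m).real B = pexp (fun e a => (m e).real {a}) (B.indicator 1) := by
  classical
  have h1 : B = ((Finset.univ.filter (· ∈ B) : Finset (E → Ω)) : Set (E → Ω)) := by ext; simp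
  conv_lhs => rw [h1]
  rw [← sum_measureReal_singleton, pexp, Finset.sum_filter]
  refine Finset.sum_congr rfl fun x _ => ?_
  by_cases hx : x ∈ B
  · rw [if_pos hx, Set.indicator_of_mem hx, Pi.one_apply, mul_one, measureReal_def,
      ← Set.univ_pi_singleton, Measure.pi_pi, ENNReal.toReal_prod]
    rfl
  · rw [if_neg hx, Set.indicator_of_notMem hx, mul_zero]

/-- The law of the indicator that `e` is an edge of a binomial random graph. -/
def edgeLaw {V : Type*} (q : I) (e : Sym2 V) : Measure Prop :=
  unitInterval.toNNReal q • Measure.dirac (¬ e.IsDiag) + unitInterval.toNNReal (σ q) • Measure.dirac False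

theorem isProbabilityMeasure_colourLaw {k : ℕ} {α : Fin k → ℝ} (hpos : ∀ i, 0 < α i)
    (hsum : ∑ i, α i = 1) : IsProbabilityMeasure (colourLaw α) := by
  constructor
  rw [colourLaw, Measure.finsetSum_apply]
  simp [← ENNReal.ofReal_sum_of_nonneg fun i _ => (hpos i).le, hsum]

theorem isProbabilityMeasure_edgeLaw {V : Type*} (q : I) (e : Sym2 V) :
    IsProbabilityMeasure (edgeLaw q e) := by
  unfold edgeLaw
  infer_instance

theorem edgeLaw_real_true {V : Type*} [DecidableEq V] (q : I) (e : Sym2 V) :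
    (edgeLaw q e).real {True} = edgeProb q e := by
  unfold edgeLaw edgeProb
  by_cases h : e.IsDiag <;> simp [h, measureReal_def]

theorem colourLaw_real_singleton {k : ℕ} {α : Fin k → ℝ} (hpos : ∀ i, 0 < α i) (i : Fin k) :
    (colourLaw α).real {i} = α i := by
  rw [colourLaw, measureReal_def, Measure.finsetSum_apply, Finset.sum_eq_single i]
  · simp [(hpos i).le]
  · intro j _ hj
    simp [hj]
  · simp

theorem binomialRandom_eq_map_pi (n : ℕ) (q : I) :
    binomialRandom (Fin n) q =
      (Measure.pi (edgeLaw q)).map fun s : Sym2 (Fin n) → Prop => fromEdgeSet {e | s e} := by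
  rw [binomialRandom_eq_map, ProbabilityTheory.setBernoulli_eq_map, Measure.map_map,
    Measure.infinitePi_eq_pi]
  · rfl
  · exact measurable_fromEdgeSet
  · exact MeasurableEquiv.setOfPred.measurable

/-- Graph and colouring are independent products over the same pairs, so the coordinates can be
regrouped into one independent (edge, colour) variable for each pair. -/
theorem randomColouredGraph_real {n k : ℕ} (q : I) {α : Fin k → ℝ} (hpos : ∀ i, 0 < α i)
    (hsum : ∑ i, α i = 1) (A : Set (SimpleGraph (Fin n) × (Sym2 (Fin n) → Fin k))) :
    (randomColouredGraph n q α).real A =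
      pexp (fun e (a : Prop × Fin k) => ((edgeLaw q e).prod (colourLaw α)).real {a})
        (Set.indicator {z | (fromEdgeSet {e | (z e).1}, fun e => (z e).2) ∈ A} 1) := by
  have := isProbabilityMeasure_colourLaw hpos hsum
  have := fun e : Sym2 (Fin n) => isProbabilityMeasure_edgeLaw q e
  have hmeas : Measurable fun s : Sym2 (Fin n) → Prop => fromEdgeSet {e | s e} :=
    measurable_fromEdgeSet.comp MeasurableEquiv.setOfPred.measurable
  have : MeasurableSingletonClass (SimpleGraph (Fin n)) := ⟨fun G => by
    have := measurableEmbedding_edgeSet.measurable (measurableSet_singleton G.edgeSet)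
    rwa [← Set.image_singleton, Set.preimage_image_eq _ edgeSet_injective] at this⟩
  have h1 : randomColouredGraph n q α = (Measure.pi fun e : Sym2 (Fin n) =>
      (edgeLaw q e).prod (colourLaw α)).map
        (fun z => (fromEdgeSet {e | (z e).1}, fun e => (z e).2)) := by
    rw [randomColouredGraph, binomialRandom_eq_map_pi]
    have h2 := measurePreserving_arrowProdEquivProdArrow Prop (Fin k) (Sym2 (Fin n))
      (edgeLaw q) (fun _ => colourLaw α)
    have h3 := Measure.map_prod_map (Measure.pi (edgeLaw q))
      (Measure.pi fun _ : Sym2 (Fin n) => colourLaw α) hmeas measurable_id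
    rw [Measure.map_id] at h3
    rw [h3, ← h2.map_eq, Measure.map_map (hmeas.prodMap measurable_id) h2.measurable]
    rfl
  rw [← measureReal_pi_eq_pexp, h1, measureReal_def, measureReal_def, Measure.map_apply]
  · rfl
  · exact .of_discrete
  · exact A.toFinite.measurableSet

/-- The random coloured graph contains a coloured Hamilton cycle with at least the probability that
the binomial random graph of density `p` contains a Hamilton cycle, if every edge of any given colour
occurs with probability at least `p`. -/
theorem one_sub_bexp_nonHamiltonian_le {n k : ℕ} (hn : 3 ≤ n) {q : I} {α : Fin k → ℝ}
    (hpos : ∀ i, 0 < α i) (hsum : ∑ i, α i = 1) (c : Fin n → Fin k) {p : ℝ} (h0 : 0 ≤ p)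
    (h1 : p ≤ 1) (hp : ∀ i, p ≤ q * α i) :
    1 - bexp (edgeProb p) ((nonHamiltonian (Fin n)).indicator 1) ≤
      (randomColouredGraph n q α).real {x | HasColouredHamiltonCycle c x.1 x.2} := by
  classical
  have := isProbabilityMeasure_colourLaw hpos hsum
  have := fun e : Sym2 (Fin n) => isProbabilityMeasure_edgeLaw q e
  rw [randomColouredGraph_real q hpos hsum]
  set w : Sym2 (Fin n) → Prop × Fin k → ℝ :=
    fun e a => ((edgeLaw q e).prod (colourLaw α)).real {a} with hw
  have hw0 : ∀ e a, 0 ≤ w e a := fun e a => measureReal_nonneg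
  have hw1 : ∀ e, ∑ a, w e a = 1 := fun e => by
    simp only [hw]
    rw [sum_measureReal_singleton, Finset.coe_univ, probReal_univ]
  -- The set of available colours: it contains colour i exactly when the pair is selected with
  -- colour i, which for a non-loop has probability q α i ≥ p.
  set h : Prop × Fin k → Finset (Fin k) := fun a => if a.1 then {a.2} else ∅ with hh
  set Q : Set (Sym2 (Fin n) → Finset (Fin k)) :=
    {A | ∃ τ ∈ cyclePatterns n, ∀ i, c i ∈ A (τ i)} with hQ
  have hcolour : pexp w (fun z => Q.indicator 1 fun e => h (z e)) ≤ pexp w (Set.indicator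
      {z | (fromEdgeSet {e | (z e).1}, fun e => (z e).2) ∈
        {x : SimpleGraph (Fin n) × (Sym2 (Fin n) → Fin k) | HasColouredHamiltonCycle c x.1 x.2}} 1) := by
    refine pexp_mono hw0 fun z => ?_
    by_cases hz : (fun e => h (z e)) ∈ Q
    · have hz' := hz
      obtain ⟨τ, hτ, hτc⟩ := hz
      have hmem : ∀ i, (z (τ i)).1 ∧ c i = (z (τ i)).2 := by
        intro i
        have := hτc i
        by_cases hi : (z (τ i)).1
        · exact ⟨hi, by simpa [hh, hi] using this⟩
        · simp [hh, hi] at this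
      rw [Set.indicator_of_mem hz', Set.indicator_of_mem]
      · rfl
      · refine hasColouredHamiltonCycle_of_cyclePattern hn hτ (fun i => ?_)
          fun i => (hmem i).2.symm
        rw [edgeSet_fromEdgeSet]
        exact ⟨(hmem i).1, not_isDiag_of_mem_cyclePatterns (by omega) hτ i⟩
    · rw [Set.indicator_of_notMem hz]
      exact Set.indicator_nonneg (fun _ _ => zero_le_one) z
  refine le_trans ?_ hcolour
  rw [pexp_map w (fun _ => h) (Q.indicator 1)]
  have hsplit : ∀ e b, 0 ≤ ∑ a, if h a = b then w e a else 0 := fun e b =>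
    Finset.sum_nonneg fun a _ => by split_ifs; exacts [hw0 e a, le_rfl]
  have hpattern := bexp_pattern_le_pexp (fun τ hτ => cyclePatterns_injective hn hτ) c
    (edgeProb_nonneg (V := Fin n) h0) (edgeProb_le_one h1)
    (μ := fun e b => ∑ a, if h a = b then w e a else 0) hsplit
    (fun e => by
      rw [Finset.sum_comm]
      simpa using hw1 e)
    (fun e i => by
      refine le_trans ?_ (Finset.single_le_sum (f := fun b : Finset (Fin k) =>
        if i ∈ b then ∑ a, if h a = b then w e a else 0 else 0)
        (fun b _ => by split_ifs; exacts [hsplit e b, le_rfl]) (Finset.mem_univ {i}))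
      simp only [Finset.mem_singleton, if_true]
      refine le_trans ?_ (Finset.single_le_sum (f := fun a => if h a = {i} then w e a else 0)
        (fun a _ => by split_ifs; exacts [hw0 e a, le_rfl])
        (Finset.mem_univ (True, i)))
      have hlaw : w e (True, i) = edgeProb q e * α i := by
        simp only [hw]
        rw [← Set.singleton_prod_singleton, measureReal_prod_prod, edgeLaw_real_true,
          colourLaw_real_singleton hpos]
      simp only [hh, if_true, hlaw]
      unfold edgeProb
      split_ifs
      · simp
      · exact hp i)
  refine le_trans ?_ hpattern
  have hcompl : bexp (edgeProb p) (fun x => 1 + (-1) * (nonHamiltonian (Fin n)).indicator 1 x) =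
      1 - bexp (edgeProb p) ((nonHamiltonian (Fin n)).indicator 1) := by
    rw [bexp_const_add_mul]; ring
  rw [← hcompl]
  refine bexp_mono (edgeProb_nonneg h0) (edgeProb_le_one h1) fun x => ?_
  by_cases hx : x ∈ nonHamiltonian (Fin n)
  · rw [Set.indicator_of_mem hx]
    simp only [Pi.one_apply, mul_one, add_neg_cancel]
    exact Set.indicator_nonneg (fun _ _ => zero_le_one) x
  · obtain ⟨l, hl⟩ := not_not.1 hx
    rw [Set.indicator_of_notMem hx, Set.indicator_of_mem
      (show x ∈ {x | ∃ τ ∈ cyclePatterns n, ∀ i, x (τ i) = true} from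
        exists_cyclePattern_of_isHamiltonList hl)]
    simp

end

theorem theorem1 (k : ℕ) (α : Fin k → ℝ) (hpos : ∀ i, 0 < α i) (hsum : ∑ i, α i = 1)
    (c : ∀ n : ℕ, Fin n → Fin k)
    (ω : ℕ → ℝ) (hω : Tendsto ω atTop atTop)
    (p : ℕ → ℝ)
    (hp : ∀ n : ℕ, p n = (Real.log n + Real.log (Real.log n) + ω n) / n)
    (q : ℕ → I) (hq : ∀ᶠ n in atTop, (q n : ℝ) = (⨅ i, α i)⁻¹ * p n) :
    Tendsto
      (fun n => randomColouredGraph n (q n) α {x | HasColouredHamiltonCycle (c n) x.1 x.2})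
      atTop (𝓝 1) := by
  have hne : Nonempty (Fin k) := by
    by_contra hne
    rw [not_nonempty_iff] at hne
    simp at hsum
  obtain ⟨i₀, hi₀⟩ := exists_eq_ciInf_of_finite (f := α)
  have hinf : 0 < ⨅ i, α i := hi₀ ▸ hpos i₀
  have hle : ∀ i, ⨅ j, α j ≤ α i := ciInf_le (Set.finite_range α).bddBelow
  have hle1 : ⨅ i, α i ≤ 1 := by
    rw [← hi₀, ← hsum]
    exact Finset.single_le_sum (fun i _ => (hpos i).le) (Finset.mem_univ i₀)
  -- Undoing the factor β gives p = q · min α, which is at most each q α i, and at most 1.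
  have hpq : ∀ᶠ n in atTop, p n = q n * ⨅ i, α i := by
    filter_upwards [hq] with n hn
    rw [hn]
    field_simp
  have hp1 : ∀ᶠ n in atTop, p n ≤ 1 := by
    filter_upwards [hpq] with n hn
    rw [hn]
    exact mul_le_one₀ (q n).2.2 hinf.le hle1
  have := isProbabilityMeasure_colourLaw hpos hsum
  have hprob : ∀ n, IsProbabilityMeasure (randomColouredGraph n (q n) α) := fun n => by
    unfold randomColouredGraph
    infer_instance
  have hlim := (tendsto_bexp_nonHamiltonian hω hp hp1).const_sub 1
  rw [sub_zero] at hlim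
  have hreal : Tendsto (fun n => (randomColouredGraph n (q n) α).real
      {x | HasColouredHamiltonCycle (c n) x.1 x.2}) atTop (𝓝 1) := by
    refine tendsto_of_tendsto_of_tendsto_of_le_of_le' hlim tendsto_const_nhds ?_
      (Eventually.of_forall fun n => measureReal_le_one)
    filter_upwards [hpq, hp1, eventually_ge_atTop 3] with n hn hn1 hn3
    refine one_sub_bexp_nonHamiltonian_le hn3 hpos hsum (c n) ?_ hn1 fun i => ?_
    · rw [hn]
      exact mul_nonneg (q n).2.1 hinf.le
    · rw [hn]
      exact mul_le_mul_of_nonneg_left (hle i) (q n).2.1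
  have := ENNReal.tendsto_ofReal hreal
  rw [ENNReal.ofReal_one] at this
  exact this.congr fun n => ofReal_measureReal
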